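/- Let $\mathcal{X}$ be a Polish space with its Borel $\sigma$-algebra and let $\mathcal{P}(\mathcal{X})$ be the set of Borel probability measures on $\mathcal{X}$. Let: 1. $P\in\mathcal{P}(\mathcal{X})$; 2. $\mathcal{L}:\mathcal{X}\to[-\infty,\infty)$ be measurable and either (a) bounded below, or (b) bounded above with $\int \mathcal{L}^-\,dP<\infty$, where $\mathcal{L}^-$ is the negative part of $\mathcal{L}$; 3. $f\in\mathcal{F}_1(a,b)$ with $a\ge 0$, that is, $0\le a<1<b\le\infty$ and $f:(a,b)\to\mathbb{R}$ is convex with $f(1)=0$; 4. $c:\mathcal{X}\times\mathcal{X}\to[0,\infty]$ be lower semicontinuous with $c(x,x)=0$ for all $x\in\mathcal{X}$. For $\mu,\nu\in\mathcal{P}(\mathcal{X})$ define the $f$-divergence $D_f(\nu\|\mu)=E_\mu[f(d\nu/d\mu)]$ if $\nu\ll\mu$ and $D_f(\nu\|\mu)=\infty$ otherwise, where $f$ is extended to $[a,b]$ by continuity and by $\infty$ outside $[a,b]$; the optimal-transport cost $C(\mu,\nu)=\inf\{\int c\,d\pi:\pi\in\mathcal{P}(\mathcal{X}\times\mathcal{X}),\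 \pi_1=\mu,\ \pi_2=\nu\}$, where $\pi_1,\pi_2$ are the marginals of $\pi$; and the OT-regularized $f$-divergence $D_f^c(\nu\|\mu)=\inf_{\eta\in\mathcal{P}(\mathcal{X})}\{D_f(\eta\|\mu)+C(\eta,\nu)\}$. Let $\mathcal{L}^c_\lambda(x)=\sup_{y\in\mathcal{X}}\{\mathcal{L}(y)/\lambda-c(x,y)\}$ for $\lambda>0$, and let $f^*(z)=\sup_{x\in(a,b)}\{zx-f(x)\}$ for $z\in\mathbb{R}$ and $f^*(\pm\infty)=\infty$. Then for all real $\epsilon>0$ and $\kappa\ge 0$, $$\sup_{Q\in\mathcal{P}(\mathcal{X}):\,D_f^c(Q\|P)\le\epsilon}\{E_Q[\mathcal{L}]-\kappa D_f^c(Q\|P)\}=\inf_{\lambda>0,\,\rho\in\mathbb{R}}\Big\{\lambda\epsilon+\rho+(\lambda+\kappa)E_P\big[f^*\big(\mathcal{L}^c_{\lambda+\kappa}-\rho/(\lambda+\kappa)\big)\big]\Big\}$$ as an equality in $[-\infty,\infty]$. For all $\lambda>0$ and $\rho\in\mathbb{R}$ the integrand $f^*(\mathcal{L}^c_{\lambda+\kappa}-\rho/(\lambda+\kappa))$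 is measurable with respect to the $P$-completion of the Borel $\sigma$-algebra, and $E_P$ denotes the integral with respect to the completion of $P$. The objective function $$(\lambda,\rho)\mapsto \lambda\epsilon+\rho+(\lambda+\kappa)E_P\big[f^*\big(\mathcal{L}^c_{\lambda+\kappa}-\rho/(\lambda+\kappa)\big)\big]$$ takes values in $(-\infty,\infty]$ and is convex on $(0,\infty)\times\mathbb{R}$. -/

import Mathlib

open MeasureTheory Set Filter Topology
open scoped ENNReal

namespace OTDRO

/-- The (quasi-)integral of an extended-real-valued function, the integral of the positive part
minus the integral of the negative part; in `EReal` one has `⊤ - ⊤ = ⊥`, the convention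
`∞ - ∞ = -∞`. For functions that are measurable only with respect to the completion of `μ`
(`AEMeasurable`), the two lower Lebesgue integrals are the integrals with respect to the
completion of `μ`. -/
noncomputable def eint {X : Type*} [MeasurableSpace X] (μ : Measure X) (φ : X → EReal) : EReal :=
  ((∫⁻ x, (φ x).toENNReal ∂μ : ℝ≥0∞) : EReal) - ((∫⁻ x, (-φ x).toENNReal ∂μ : ℝ≥0∞) : EReal)

/-- The open interval `(a, b)` of real numbers with possibly infinite endpoints. -/
def realIoo (a b : EReal) : Set ℝ := {x : ℝ | a < (x : EReal) ∧ (x : EReal) < b}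

/-- The class `F₁(a, b)`: `-∞ ≤ a < 1 < b ≤ ∞`, and `f` is convex on `(a, b)` with `f 1 = 0`.
The values of `f` outside of `(a, b)` are never used. -/
structure IsF1 (a b : EReal) (f : ℝ → ℝ) : Prop where
  lt_one : a < 1
  one_lt : 1 < b
  convexOn : ConvexOn ℝ (realIoo a b) f
  map_one : f 1 = 0

open Classical in
/-- The extension of `f : (a, b) → ℝ` to the real line with values in `(-∞, ∞]`: by continuity
at the finite endpoints of the interval, and by `∞` outside of `[a, b]`. -/
noncomputable def fExt (a b : EReal) (f : ℝ → ℝ) (x : ℝ) : EReal :=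
  if x ∈ realIoo a b then (f x : EReal)
  else if (x : EReal) = a ∨ (x : EReal) = b then
    extendFrom (realIoo a b) (fun y : ℝ => (f y : EReal)) x
  else ⊤

open Classical in
/-- The Legendre transform `f*(z) = sup_{x ∈ (a, b)} (z x - f x)`, extended by `f*(±∞) = ∞`. -/
noncomputable def fConj (a b : EReal) (f : ℝ → ℝ) (z : EReal) : EReal :=
  if z = ⊤ ∨ z = ⊥ then ⊤
  else ⨆ x ∈ realIoo a b, ((z.toReal * x - f x : ℝ) : EReal)

open Classical in
/-- The `f`-divergence `D_f(ν ‖ μ)`. -/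
noncomputable def fDiv {X : Type*} [MeasurableSpace X] (a b : EReal) (f : ℝ → ℝ)
    (ν μ : ProbabilityMeasure X) : EReal :=
  if (ν : Measure X) ≪ (μ : Measure X) then
    eint (μ : Measure X) (fun x => fExt a b f (((ν : Measure X).rnDeriv (μ : Measure X) x).toReal))
  else ⊤

/-- The optimal-transport cost `C(μ, ν)`, the infimum of `∫ c dπ` over couplings `π`. -/
noncomputable def otCost {X : Type*} [MeasurableSpace X] (c : X × X → ℝ≥0∞)
    (μ ν : ProbabilityMeasure X) : ℝ≥0∞ :=
  ⨅ (π : ProbabilityMeasure (X × X))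
    (_ : (π : Measure (X × X)).map Prod.fst = (μ : Measure X) ∧
      (π : Measure (X × X)).map Prod.snd = (ν : Measure X)),
    ∫⁻ p, c p ∂(π : Measure (X × X))

/-- The OT-regularized divergence `D^c(ν ‖ μ) = inf_η (D(η ‖ μ) + C(η, ν))`. -/
noncomputable def otDiv {X : Type*} [MeasurableSpace X]
    (D : ProbabilityMeasure X → ProbabilityMeasure X → EReal) (c : X × X → ℝ≥0∞)
    (ν μ : ProbabilityMeasure X) : EReal :=
  ⨅ η : ProbabilityMeasure X, (D η μ + (otCost c η ν : EReal))

/-- The OT-regularized loss `L^c_lam(x) = sup_y (L(y) / lam - c(x, y))`. -/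
noncomputable def regLoss {X : Type*} (c : X × X → ℝ≥0∞) (L : X → EReal) (lam : ℝ) (x : X) :
    EReal :=
  ⨆ y : X, (L y / (lam : EReal) - (c (x, y) : EReal))

/-- The integrand `f*(L^c_{lam + κ} - ρ / (lam + κ))` of the dual objective. -/
noncomputable def dualIntegrand {X : Type*} (a b : EReal) (f : ℝ → ℝ) (c : X × X → ℝ≥0∞)
    (L : X → EReal) (κ lam ρ : ℝ) (x : X) : EReal :=
  fConj a b f (regLoss c L (lam + κ) x - ((ρ / (lam + κ) : ℝ) : EReal))

/-- The dual objective `lam ε + ρ + (lam + κ) E_P[f*(L^c_{lam + κ} - ρ / (lam + κ))]`. -/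
noncomputable def dualObjective {X : Type*} [MeasurableSpace X] (a b : EReal) (f : ℝ → ℝ)
    (c : X × X → ℝ≥0∞) (L : X → EReal) (P : ProbabilityMeasure X) (ε κ lam ρ : ℝ) : EReal :=
  ((lam * ε + ρ : ℝ) : EReal) +
    ((lam + κ : ℝ) : EReal) * eint (P : Measure X) (dualIntegrand a b f c L κ lam ρ)

/-- Convexity on a convex set of a function with values in `(-∞, ∞]`. -/
def EConvexOn {E : Type*} [AddCommGroup E] [Module ℝ E] (S : Set E) (F : E → EReal) : Prop :=
  Convex ℝ S ∧ (∀ p ∈ S, ⊥ < F p) ∧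
    ∀ p ∈ S, ∀ q ∈ S, ∀ s t : ℝ, 0 ≤ s → 0 ≤ t → s + t = 1 →
      F (s • p + t • q) ≤ (s : EReal) * F p + (t : EReal) * F q

end OTDRO

/-! The equality is Lagrangian duality for a convex problem over transport plans. Write l = lam + κ.

Upper bound on the primal (`weak_duality`). Let π couple η = φP to Q. By definition of the
regularized loss g, L(y) ≤ l (c(x,y) + g(x)), and Young's inequality gives φ g ≤ f(φ) + f*(g - ρ/l)
+ (ρ/l) φ. Integrating bounds E_Q[L] by l (divergence + transport cost + E_P f*) + ρ. After taking
infima over η and π, subtracting κ times the regularized divergence leaves lam times it, which is at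
most lam ε. The delicate point is integrability (`eint_le_of_coupling`).

Lower bound. Drop the normalization of η: a plan has first marginal φP of arbitrary mass. The
triples (mass, divergence + cost, value) dominated by plans form a convex set (`convex_attainable`).
If v is the finite primal value, (1, ε, v + δ/2) lies outside this set, because a plan of mass 1 is
primal feasible. The diagonal plan of P is a Slater point, of cost 0 < ε, and constant densities
near 1 supply interior points, so Hahn-Banach produces multipliers lam for the cost and ρ for the
mass (`exists_multipliers`).

For a plan that moves x to s(x) with density φ, the Lagrangian is the integral of l times `lagr`, up
to a constant. As a ≥ 0, f* is nondecreasing on the reals, so the supremum over y passes through f*,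
and the dual integrand is the pointwise supremum of `lagr` over t and y (`le_dualIntegrand`,
`exists_lt_lagr`). Measurable selection interchanges supremum and integral
(`integral_le_of_lt_dualIntegrand`), so the dual objective at (lam, ρ) is at most v + δ.

The other claims use the same formula. Superlevel sets of the regularized loss are projections of
Borel sets, hence analytic and universally measurable. The product of l and `lagr` is affine in
(lam, ρ), so its supremum is convex. -/

namespace OTDRO

/-! ### Analytic sets: capacitability, universal measurability, measurable selection. -/

/-- A continuous image of the Baire space is approximated in outer measure from inside by images of
compact sets. -/
theorem exists_isCompact_le_measure_image {X : Type*} [TopologicalSpace X] [MeasurableSpace X]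
    (μ : Measure X) [μ.OuterRegular] {p : (ℕ → ℕ) → X} (hp : Continuous p) {r : ℝ≥0∞}
    (hr : r < μ (range p)) : ∃ K : Set (ℕ → ℕ), IsCompact K ∧ r ≤ μ (p '' K) := by
  -- One coordinate can be bounded while the outer measure stays above r, since outer measure is
  -- continuous along increasing unions of arbitrary sets.
  have step : ∀ (C : Set (ℕ → ℕ)) (k : ℕ), r < μ (p '' C) →
      ∃ m : ℕ, r < μ (p '' (C ∩ {x | x k ≤ m})) := by
    intro C k hC
    have hU : p '' C = ⋃ m : ℕ, p '' (C ∩ {x | x k ≤ m}) := by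
      rw [← image_iUnion, ← inter_iUnion]
      congr 1
      ext x
      simpa using fun _ => ⟨x k, le_rfl⟩
    have hmono : Monotone fun m : ℕ => p '' (C ∩ {x | x k ≤ m}) := fun m m' h =>
      image_mono (inter_subset_inter_right _ fun x (hx : x k ≤ m) => hx.trans h)
    rw [hU, hmono.measure_iUnion] at hC
    exact lt_iSup_iff.1 hC
  choose! m hm using step
  let S : ℕ → {C : Set (ℕ → ℕ) // r < μ (p '' C)} := fun k =>
    Nat.rec ⟨univ, by rwa [image_univ]⟩
      (fun k C => ⟨C.1 ∩ {x | x k ≤ m C.1 k}, hm C.1 k C.2⟩) k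
  let n : ℕ → ℕ := fun k => m (S k).1 k
  have hS : ∀ k, (S k).1 = {x | ∀ i < k, x i ≤ n i} := by
    intro k
    induction k with
    | zero => simp [S]
    | succ k ih =>
      have : (S (k + 1)).1 = (S k).1 ∩ {x | x k ≤ n k} := rfl
      rw [this, ih]
      ext x
      simp only [mem_inter_iff, mem_ofPred_eq, Nat.lt_succ_iff_lt_or_eq]
      constructor
      · rintro ⟨h1, h2⟩ i (hi | rfl)
        exacts [h1 i hi, h2]
      · exact fun h => ⟨fun i hi => h i (Or.inl hi), h k (Or.inr rfl)⟩
  let K : Set (ℕ → ℕ) := univ.pi fun i => Iic (n i)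
  have hK : IsCompact K := isCompact_univ_pi fun i => (finite_Iic (n i)).isCompact
  refine ⟨K, hK, ?_⟩
  by_contra! hlt
  -- Only finitely many coordinates are bounded on each `S k`, so each contains a point mapped
  -- outside U. Truncating these points to K and using compactness gives a limit in K whose image
  -- would lie in U.
  obtain ⟨U, hKU, hUo, hUr⟩ := Set.exists_isOpen_lt_of_lt _ _ hlt
  have hne : ∀ k, ∃ x, x ∈ (S k).1 ∧ p x ∉ U := by
    intro k
    by_contra! h
    exact absurd ((S k).2.trans_le (measure_mono (image_subset_iff.2 h))) hUr.not_gt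
  choose x hxS hxU using hne
  let y : ℕ → ℕ → ℕ := fun k i => if i < k then x k i else 0
  have hy : ∀ k, y k ∈ K := by
    intro k i _
    by_cases hi : i < k
    · have := hxS k
      rw [hS] at this
      simpa [y, hi] using this i hi
    · simp [y, hi]
  obtain ⟨z, hz, φ, hφ, hlim⟩ := hK.tendsto_subseq hy
  have hlim' : Tendsto (fun j => x (φ j)) atTop (𝓝 z) := by
    rw [tendsto_pi_nhds] at hlim ⊢
    intro i
    refine (hlim i).congr' ?_
    filter_upwards [eventually_gt_atTop i] with j hj
    have : i < φ j := hj.trans_le (hφ.id_le j)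
    simp [y, this]
  have := ((hp.tendsto z).comp hlim').eventually (hUo.mem_nhds (hKU (mem_image_of_mem p hz)))
  obtain ⟨j, hj⟩ := this.exists
  exact hxU _ hj

/-- There is a continuous injection of the Baire space into the real line. -/
theorem exists_continuous_injective_real :
    ∃ e : (ℕ → ℕ) → ℝ, Continuous e ∧ Function.Injective e := by
  -- The indicator of the graph of x, coded by pairing, is a point of the Cantor space, which embeds
  -- in ℝ.
  let e₁ : (ℕ → ℕ) → ℕ → Bool := fun x k => decide (x k.unpair.1 = k.unpair.2)
  have h₁ : Continuous e₁ := continuous_pi fun k =>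
    (continuous_of_discreteTopology (f := fun j : ℕ => decide (j = k.unpair.2))).comp
      (continuous_apply k.unpair.1)
  have h₂ : Function.Injective e₁ := by
    intro x y h
    ext i
    have := congrFun h (Nat.pair i (x i))
    simp only [e₁, Nat.unpair_pair, decide_true] at this
    exact (of_decide_eq_true this.symm).symm
  exact ⟨fun x => (cantorSetHomeomorphNatToBool.symm (e₁ x) : ℝ),
    continuous_subtype_val.comp (cantorSetHomeomorphNatToBool.symm.continuous.comp h₁),
    Subtype.val_injective.comp (cantorSetHomeomorphNatToBool.symm.injective.comp h₂)⟩

/-- A continuous map on a compact subset of the Baire space has a Borel right inverse. -/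
theorem exists_measurable_section_of_isCompact {X : Type*} [TopologicalSpace X] [T2Space X]
    [MeasurableSpace X] [BorelSpace X] {p : (ℕ → ℕ) → X} (hp : Continuous p) {K : Set (ℕ → ℕ)}
    (hK : IsCompact K) :
    ∃ σ : X → ℕ → ℕ, Measurable σ ∧ ∀ x ∈ p '' K, p (σ x) = x := by
  classical
  obtain ⟨e, he, hinj⟩ := exists_continuous_injective_real
  obtain ⟨e', he', hee'⟩ := (he.measurableEmbedding hinj).exists_measurable_extend measurable_id
    fun _ => ⟨fun _ => 0⟩
  have hcomp : ∀ x, IsCompact (e '' (K ∩ p ⁻¹' {x})) := fun x =>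
    (hK.inter_right (isClosed_singleton.preimage hp)).image he
  have hmem : ∀ x ∈ p '' K, sInf (e '' (K ∩ p ⁻¹' {x})) ∈ e '' (K ∩ p ⁻¹' {x}) := by
    rintro x ⟨y, hy, rfl⟩
    exact (hcomp _).sInf_mem ⟨e y, mem_image_of_mem e ⟨hy, rfl⟩⟩
  -- The section picks the point of the compact fibre with least image under e. Sublevel sets of
  -- this minimum are images of compact sets, apart from points with empty fibre, where `sInf ∅ =
  -- 0`.
  have hmeas : Measurable fun x => sInf (e '' (K ∩ p ⁻¹' {x})) := by
    refine measurable_of_Iic fun t => ?_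
    have : (fun x => sInf (e '' (K ∩ p ⁻¹' {x}))) ⁻¹' Iic t =
        p '' (K ∩ e ⁻¹' Iic t) ∪ ((p '' K)ᶜ ∩ {_x | (0 : ℝ) ≤ t}) := by
      ext x
      by_cases hx : x ∈ p '' K
      · simp only [mem_preimage, mem_Iic, mem_union, mem_inter_iff, mem_compl_iff, hx,
          not_true_eq_false, false_and, or_false]
        constructor
        · intro h
          obtain ⟨y, ⟨hyK, hyx⟩, hy⟩ := hmem x hx
          exact ⟨y, ⟨hyK, by simpa [hy] using h⟩, hyx⟩
        · rintro ⟨y, ⟨hyK, hyt⟩, rfl⟩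
          exact (csInf_le (hcomp _).bddBelow (mem_image_of_mem e ⟨hyK, rfl⟩)).trans hyt
      · have h0 : K ∩ p ⁻¹' {x} = ∅ := by
          ext y
          simp only [mem_inter_iff, mem_preimage, mem_singleton_iff, mem_empty_iff_false, iff_false]
          exact fun h => hx ⟨y, h⟩
        have h1 : x ∉ p '' (K ∩ e ⁻¹' Iic t) := fun h => hx (image_mono inter_subset_left h)
        simp only [mem_preimage, mem_Iic, mem_union, mem_inter_iff, mem_compl_iff, hx, h1, h0,
          image_empty, Real.sInf_empty, mem_ofPred_eq, not_false_eq_true, true_and, false_or]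
    rw [this]
    exact ((hK.inter_right (isClosed_Iic.preimage he)).image hp).measurableSet.union
      ((hK.image hp).measurableSet.compl.inter (MeasurableSet.const _))
  refine ⟨_, he'.comp hmeas, fun x hx => ?_⟩
  obtain ⟨y, ⟨-, hyx⟩, hy⟩ := hmem x hx
  have : e' (e y) = y := congrFun hee' y
  simpa [← hy, this] using hyx

/-- Analytic sets are measurable with respect to the completion of a finite Borel measure. -/
theorem AnalyticSet.nullMeasurableSet {X : Type*} [TopologicalSpace X] [PolishSpace X]
    [MeasurableSpace X] [BorelSpace X] {s : Set X} (hs : AnalyticSet s) (μ : Measure X)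
    [IsFiniteMeasure μ] : NullMeasurableSet s μ := by
  rw [AnalyticSet] at hs
  obtain rfl | ⟨p, hp, rfl⟩ := hs
  · exact nullMeasurableSet_empty
  by_cases h0 : μ (range p) = 0
  · exact NullMeasurableSet.of_null h0
  obtain ⟨u, -, hu, hlim⟩ := exists_seq_strictMono_tendsto' (pos_iff_ne_zero.2 h0)
  choose K hK hKu using fun n => exists_isCompact_le_measure_image μ hp (hu n).2
  let T := ⋃ n, p '' K n
  have hT : MeasurableSet T := MeasurableSet.iUnion fun n => ((hK n).image hp).measurableSet
  have hTs : T ⊆ range p := iUnion_subset fun n => image_subset_range _ _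
  have hle : μ (range p) ≤ μ T := le_of_tendsto' hlim fun n =>
    (hKu n).trans (measure_mono (subset_iUnion (fun n => p '' K n) n))
  exact hT.nullMeasurableSet.congr
    (ae_eq_of_subset_of_measure_ge hTs hle hT.nullMeasurableSet (measure_ne_top _ _))

/-- Measurable selection up to a set of small measure. -/
theorem exists_measurable_section {X Z : Type*} [TopologicalSpace X] [PolishSpace X]
    [MeasurableSpace X] [BorelSpace X] [TopologicalSpace Z] [PolishSpace Z] [MeasurableSpace Z]
    [BorelSpace Z] [Nonempty Z] (μ : Measure X) [IsFiniteMeasure μ] {A : Set (X × Z)}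
    (hA : MeasurableSet A) {r : ℝ≥0∞} (hr : r < μ (Prod.fst '' A)) :
    ∃ (B : Set X) (s : X → Z), MeasurableSet B ∧ Measurable s ∧ r ≤ μ B ∧
      ∀ x ∈ B, (x, s x) ∈ A := by
  -- Parametrize A by the Baire space via g, choose a section of the first coordinate of g over a
  -- compact image, and read off the second coordinate.
  have hs : AnalyticSet A := hA.analyticSet
  rw [AnalyticSet] at hs
  obtain rfl | ⟨g, hg, rfl⟩ := hs
  · simp at hr
  rw [← range_comp] at hr
  have hp : Continuous (Prod.fst ∘ g) := continuous_fst.comp hg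
  obtain ⟨K, hK, hKr⟩ := exists_isCompact_le_measure_image μ hp hr
  obtain ⟨σ, hσ, hσp⟩ := exists_measurable_section_of_isCompact hp hK
  refine ⟨_, fun x => (g (σ x)).2, (hK.image hp).measurableSet,
    measurable_snd.comp (hg.measurable.comp hσ), hKr, fun x hx => ⟨σ x, ?_⟩⟩
  exact Prod.ext (hσp x hx) rfl

/-! ### The extended-real integral. -/

section eint

variable {X : Type*} [MeasurableSpace X] {μ : Measure X} {F G : X → EReal} {g h : X → ℝ}

theorem eint_congr_ae (hFG : F =ᵐ[μ] G) : eint μ F = eint μ G := by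
  unfold eint
  have h1 : ∫⁻ x, (F x).toENNReal ∂μ = ∫⁻ x, (G x).toENNReal ∂μ :=
    lintegral_congr_ae (by filter_upwards [hFG] with x hx; rw [hx])
  have h2 : ∫⁻ x, (-F x).toENNReal ∂μ = ∫⁻ x, (-G x).toENNReal ∂μ :=
    lintegral_congr_ae (by filter_upwards [hFG] with x hx; rw [hx])
  rw [h1, h2]

theorem eint_coe (hg : Integrable g μ) :
    eint μ (fun x => (g x : EReal)) = ((∫ x, g x ∂μ : ℝ) : EReal) := by
  have h1 : ∫⁻ x, ENNReal.ofReal (g x) ∂μ ≠ ⊤ := hg.lintegral_lt_top.ne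
  have h2 : ∫⁻ x, ENNReal.ofReal (-g x) ∂μ ≠ ⊤ := hg.neg.lintegral_lt_top.ne
  unfold eint
  simp only [← EReal.coe_neg, EReal.real_coe_toENNReal]
  rw [integral_eq_lintegral_pos_part_sub_lintegral_neg_part hg, EReal.coe_sub,
    EReal.coe_ennreal_toReal h1, EReal.coe_ennreal_toReal h2]

theorem eint_eq_integral (hg : Integrable g μ) (hF : F =ᵐ[μ] fun x => (g x : EReal)) :
    eint μ F = ((∫ x, g x ∂μ : ℝ) : EReal) := by
  rw [eint_congr_ae hF, eint_coe hg]

theorem lintegral_neg_ne_top (hh : Integrable h μ) (hF : ∀ᵐ x ∂μ, (h x : EReal) ≤ F x) :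
    ∫⁻ x, (-F x).toENNReal ∂μ ≠ ⊤ := by
  refine ((lintegral_mono_ae ?_).trans_lt hh.neg.lintegral_lt_top).ne
  filter_upwards [hF] with x hx
  rw [← EReal.real_coe_toENNReal, Pi.neg_apply, EReal.coe_neg]
  exact EReal.toENNReal_le_toENNReal (EReal.neg_le_neg_iff.2 hx)

theorem bot_lt_eint (hh : Integrable h μ) (hF : ∀ᵐ x ∂μ, (h x : EReal) ≤ F x) :
    ⊥ < eint μ F := by
  have h1 := lintegral_neg_ne_top hh hF
  unfold eint
  generalize ∫⁻ x, (-F x).toENNReal ∂μ = u at h1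
  lift u to NNReal using h1
  generalize ∫⁻ x, (F x).toENNReal ∂μ = v
  rw [bot_lt_iff_ne_bot, sub_eq_add_neg, Ne, EReal.add_eq_bot_iff, not_or, EReal.neg_eq_bot_iff]
  exact ⟨EReal.coe_ennreal_ne_bot v, by simp⟩

theorem lintegral_pos_ne_top (hneg : ∫⁻ x, (-F x).toENNReal ∂μ ≠ ⊤) (ht : eint μ F ≠ ⊤) :
    ∫⁻ x, (F x).toENNReal ∂μ ≠ ⊤ := by
  intro h
  refine ht ?_
  unfold eint
  generalize ∫⁻ x, (-F x).toENNReal ∂μ = u at hneg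
  lift u to NNReal using hneg
  rw [h]
  rfl

/-- A function whose positive and negative parts have finite integrals agrees almost everywhere
with an integrable real-valued function. -/
theorem integrable_toReal (hF : AEMeasurable F μ) (hpos : ∫⁻ x, (F x).toENNReal ∂μ ≠ ⊤)
    (hneg : ∫⁻ x, (-F x).toENNReal ∂μ ≠ ⊤) :
    Integrable (fun x => (F x).toReal) μ ∧ F =ᵐ[μ] fun x => ((F x).toReal : EReal) := by
  have hF' : AEMeasurable (fun x => -F x) μ := continuous_neg.measurable.comp_aemeasurable hF
  constructor
  · refine ⟨hF.ereal_toReal.aestronglyMeasurable, ?_⟩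
    rw [hasFiniteIntegral_iff_norm]
    refine lt_of_le_of_lt (lintegral_mono fun x => ?_)
      ((lintegral_add_left' hF.ereal_toENNReal _).trans_lt (ENNReal.add_lt_top.2
        ⟨hpos.lt_top, hneg.lt_top⟩))
    induction F x with
    | bot => simp
    | top => simp
    | coe r =>
      rw [EReal.toReal_coe, ← EReal.coe_neg, EReal.real_coe_toENNReal, EReal.real_coe_toENNReal,
        Real.norm_eq_abs]
      rcases le_total 0 r with hr | hr
      · rw [abs_of_nonneg hr]; exact le_self_add
      · rw [abs_of_nonpos hr]; exact le_add_self
  · filter_upwards [ae_lt_top' hF.ereal_toENNReal hpos, ae_lt_top' hF'.ereal_toENNReal hneg]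
      with x h1 h2
    refine (EReal.coe_toReal ?_ ?_).symm
    · exact EReal.toENNReal_ne_top_iff.1 h1.ne
    · intro h
      exact EReal.toENNReal_ne_top_iff.1 h2.ne (by simp [h])

theorem integrable_toReal_of_eint_ne_top (hF : AEMeasurable F μ) (hh : Integrable h μ)
    (hhF : ∀ᵐ x ∂μ, (h x : EReal) ≤ F x) (ht : eint μ F ≠ ⊤) :
    Integrable (fun x => (F x).toReal) μ ∧ F =ᵐ[μ] fun x => ((F x).toReal : EReal) :=
  have hneg := lintegral_neg_ne_top hh hhF
  integrable_toReal hF (lintegral_pos_ne_top hneg ht) hneg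

/-- The integral of a function with an integrable minorant is bounded by a constant as soon as
the integrals of its integrable strict minorants are. -/
theorem eint_le_of_forall_lt [IsFiniteMeasure μ] (hF : AEMeasurable F μ) (hh : Integrable h μ)
    (hhF : ∀ᵐ x ∂μ, (h x : EReal) ≤ F x) {C : ℝ}
    (hC : ∀ g : X → ℝ, Measurable g → Integrable g μ → (∀ᵐ x ∂μ, (g x : EReal) < F x) →
      ∫ x, g x ∂μ ≤ C) : eint μ F ≤ (C : EReal) := by
  have hneg := lintegral_neg_ne_top hh hhF
  -- F is truncated at n: the truncations are integrable, share the negative part of F because n ≥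
  -- 0, and their positive parts increase to that of F.
  have hFn : ∀ n : ℕ, AEMeasurable (fun x => min (F x) ((n : ℝ) : EReal)) μ := fun n =>
    hF.min aemeasurable_const
  have hint : ∀ n : ℕ, Integrable (fun x => (min (F x) ((n : ℝ) : EReal)).toReal) μ ∧
      (fun x => min (F x) ((n : ℝ) : EReal)) =ᵐ[μ]
        fun x => ((min (F x) ((n : ℝ) : EReal)).toReal : EReal) := by
    intro n
    refine integrable_toReal (hFn n) ?_ ?_
    · refine ((lintegral_mono fun x => EReal.toENNReal_le_toENNReal (min_le_right _ _)).trans_lt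
        ?_).ne
      rw [lintegral_const, EReal.real_coe_toENNReal]
      exact ENNReal.mul_lt_top ENNReal.ofReal_lt_top (measure_lt_top _ _)
    · refine lintegral_neg_ne_top (h := fun x => min (h x) n) (hh.inf (integrable_const _)) ?_
      filter_upwards [hhF] with x hx
      refine le_min ((EReal.coe_le_coe_iff.2 (min_le_left _ _)).trans hx)
        (EReal.coe_le_coe_iff.2 (min_le_right _ _))
  have hle : ∀ n : ℕ, eint μ (fun x => min (F x) ((n : ℝ) : EReal)) ≤ (C : EReal) := by
    intro n
    obtain ⟨hi, he⟩ := hint n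
    rw [eint_eq_integral hi he, EReal.coe_le_coe_iff]
    refine le_of_forall_pos_le_add fun δ hδ => ?_
    -- Lowering by a constant turns the truncation into a strict minorant; the summand 1 in the
    -- denominator covers the zero measure.
    obtain ⟨δ', hδ', hδδ'⟩ : ∃ δ' : ℝ, 0 < δ' ∧ μ.real univ * δ' ≤ δ := by
      refine ⟨δ / (μ.real univ + 1), by positivity, ?_⟩
      rw [mul_div_assoc', div_le_iff₀ (by positivity)]
      nlinarith [measureReal_nonneg (μ := μ) (s := univ)]
    obtain ⟨u, hu, hgu⟩ := hi.aestronglyMeasurable.aemeasurable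
    have hiu : Integrable u μ := hi.congr hgu
    have h1 := hC (fun x => u x - δ') (hu.sub_const _) (hiu.sub (integrable_const _)) (by
      filter_upwards [hgu, he] with x h1 h2
      calc ((u x - δ' : ℝ) : EReal) < (u x : EReal) := EReal.coe_lt_coe_iff.2 (by linarith)
        _ = min (F x) ((n : ℝ) : EReal) := by rw [h2, h1]
        _ ≤ F x := min_le_left _ _)
    rw [integral_sub hiu (integrable_const _), integral_const, smul_eq_mul] at h1
    rw [integral_congr_ae hgu]
    linarith
  have hnegn : ∀ n : ℕ, ∫⁻ x, (-(min (F x) ((n : ℝ) : EReal))).toENNReal ∂μ =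
      ∫⁻ x, (-F x).toENNReal ∂μ := by
    refine fun n => lintegral_congr fun x => ?_
    rcases le_total (F x) ((n : ℝ) : EReal) with h | h
    · rw [min_eq_left h]
    · have h0 : (0 : EReal) ≤ ((n : ℝ) : EReal) := by exact_mod_cast n.cast_nonneg
      rw [min_eq_right h, EReal.toENNReal_of_nonpos, EReal.toENNReal_of_nonpos]
      · simpa using h0.trans h
      · simp
  have hmono : Monotone EReal.toENNReal := fun _ _ => EReal.toENNReal_le_toENNReal
  have hposn : ∀ n : ℕ, ∫⁻ x, (min (F x) ((n : ℝ) : EReal)).toENNReal ∂μ =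
      ∫⁻ x, min (F x).toENNReal n ∂μ := by
    refine fun n => lintegral_congr fun x => ?_
    rw [hmono.map_min, EReal.real_coe_toENNReal, ENNReal.ofReal_natCast]
  have hsup : ∫⁻ x, (F x).toENNReal ∂μ = ⨆ n : ℕ, ∫⁻ x, min (F x).toENNReal n ∂μ := by
    rw [← lintegral_iSup' (fun n => hF.ereal_toENNReal.min aemeasurable_const)
      (ae_of_all _ fun x n m hnm => min_le_min_left _ (by exact_mod_cast hnm))]
    refine lintegral_congr fun x => ?_
    rw [← inf_iSup_eq, ENNReal.iSup_natCast, inf_top_eq]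
  unfold eint at hle ⊢
  simp only [hnegn, hposn] at hle
  generalize ∫⁻ x, (-F x).toENNReal ∂μ = N at hneg hle
  lift N to NNReal using hneg
  -- This moves the bound to `ℝ≥0∞`, where the supremum over n can be taken. The sign condition is
  -- recorded separately because `ENNReal.ofReal` sends negative numbers to 0.
  have hN : ∀ P : ℝ≥0∞, ((P : EReal) - ((N : ℝ≥0∞) : EReal) ≤ C ↔
      P ≤ ENNReal.ofReal (C + N) ∧ 0 ≤ C + N) := by
    intro P
    induction P with
    | top => exact ⟨fun h => absurd (top_le_iff.1 h) (EReal.coe_ne_top _), fun h => by simp at h⟩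
    | coe P =>
      have : ((P : ℝ≥0∞) : EReal) - ((N : ℝ≥0∞) : EReal) = ((P - N : ℝ) : EReal) := rfl
      rw [this, EReal.coe_le_coe_iff, sub_le_iff_le_add]
      constructor
      · intro h
        have h0 : 0 ≤ C + N := P.2.trans h
        rw [ENNReal.le_ofReal_iff_toReal_le (by simp) h0, ENNReal.coe_toReal]
        exact ⟨h, h0⟩
      · rintro ⟨h, h0⟩
        rwa [ENNReal.le_ofReal_iff_toReal_le (by simp) h0, ENNReal.coe_toReal] at h
  rw [hN, hsup]
  exact ⟨iSup_le fun n => ((hN _).1 (hle n)).1, ((hN _).1 (hle 0)).2⟩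

end eint

/-! ### The function f, its extension and its conjugate. -/

section convex

variable {a b : EReal} {f : ℝ → ℝ}

theorem isOpen_realIoo (a b : EReal) : IsOpen (realIoo a b) :=
  (isOpen_Ioi.preimage continuous_coe_real_ereal).inter
    (isOpen_Iio.preimage continuous_coe_real_ereal)

theorem pos_of_mem_realIoo (ha : 0 ≤ a) {t : ℝ} (ht : t ∈ realIoo a b) : 0 < t := by
  exact_mod_cast ha.trans_lt ht.1

namespace IsF1

theorem one_mem (hf : IsF1 a b f) : (1 : ℝ) ∈ realIoo a b :=
  ⟨by simpa using hf.lt_one, by simpa using hf.one_lt⟩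

theorem continuousOn (hf : IsF1 a b f) : ContinuousOn f (realIoo a b) :=
  hf.convexOn.continuousOn (isOpen_realIoo a b)

theorem measurable_indicator (hf : IsF1 a b f) : Measurable ((realIoo a b).indicator f) := by
  classical
  rw [← piecewise_eq_indicator]
  exact hf.continuousOn.measurable_piecewise continuousOn_const (isOpen_realIoo a b).measurableSet

theorem measurable_comp (hf : IsF1 a b f) {X : Type*} [MeasurableSpace X] {φ : X → ℝ}
    (hφ : Measurable φ) (hφm : ∀ x, φ x ∈ realIoo a b) : Measurable fun x => f (φ x) := by
  have : (fun x => f (φ x)) = fun x => (realIoo a b).indicator f (φ x) :=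
    funext fun x => (indicator_of_mem (hφm x) f).symm
  rw [this]
  exact hf.measurable_indicator.comp hφ

/-- A convex function on an open interval has a supporting line at `1`. -/
theorem exists_subgradient (hf : IsF1 a b f) :
    ∃ s : ℝ, ∀ t ∈ realIoo a b, s * (t - 1) ≤ f t := by
  have hint : (1 : ℝ) ∈ interior (realIoo a b) := by
    rw [(isOpen_realIoo a b).interior_eq]; exact hf.one_mem
  refine ⟨derivWithin f (Ioi 1) 1, fun t ht => ?_⟩
  rcases lt_trichotomy t 1 with h | rfl | h
  · have h1 := (hf.convexOn.slope_le_leftDeriv_of_mem_interior ht hint h).trans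
      (hf.convexOn.leftDeriv_le_rightDeriv_of_mem_interior hint)
    rw [slope_def_field, hf.map_one, div_le_iff₀ (by linarith)] at h1
    linarith
  · simp [hf.map_one]
  · have h1 := hf.convexOn.rightDeriv_le_slope_of_mem_interior hint ht h
    rwa [slope_def_field, hf.map_one, sub_zero, le_div_iff₀ (by linarith)] at h1

/-- As f(1) = 0, f(y) is its slope from 1 times y - 1. The second factor has a nonzero limit, so the
product converges even where the slope tends to ±∞. -/
theorem tendsto_of_tendsto_slope (hf : IsF1 a b f) {x : ℝ} (hx : x ≠ 1) {l : Filter ℝ} (hl : l ≤ 𝓝 x)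
    {m : EReal} (h : Tendsto (fun y => ((slope f 1 y : ℝ) : EReal)) l (𝓝 m)) :
    ∃ m' : EReal, Tendsto (fun y => (f y : EReal)) l (𝓝 m') := by
  have hx0 : ((x - 1 : ℝ) : EReal) ≠ 0 := by
    rw [Ne, EReal.coe_eq_zero]
    exact sub_ne_zero.2 hx
  have h2 : Tendsto (fun y : ℝ => ((y - 1 : ℝ) : EReal)) l (𝓝 ((x - 1 : ℝ) : EReal)) :=
    EReal.tendsto_coe.2 (((continuous_id.sub continuous_const).tendsto x).mono_left hl)
  refine ⟨_, (EReal.Tendsto.mul h h2 (Or.inr (EReal.coe_ne_bot _)) (Or.inr (EReal.coe_ne_top _))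
    (Or.inr hx0) (Or.inr hx0)).congr fun y => ?_⟩
  rw [← EReal.coe_mul, slope_def_field, hf.map_one, sub_zero]
  by_cases hy : y = 1
  · simp [hy, hf.map_one]
  · rw [div_mul_cancel₀ _ (sub_ne_zero.2 hy)]

/-- Slopes of a convex function from 1 are monotone, hence have one-sided limits. This makes the
extension at a finite endpoint a genuine limit rather than the default value of `extendFrom`. -/
theorem exists_tendsto (hf : IsF1 a b f) {x : ℝ} (hx : (x : EReal) = a ∨ (x : EReal) = b) :
    x ∈ closure (realIoo a b) ∧
      ∃ m : EReal, Tendsto (fun y => (f y : EReal)) (𝓝[realIoo a b] x) (𝓝 m) := by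
  have hslope := hf.convexOn.slope_mono hf.one_mem
  rw [mem_closure_iff_nhdsWithin_neBot]
  rcases hx with rfl | rfl
  · have hx1 : x < 1 := by exact_mod_cast hf.lt_one
    have hsub : Ioo x 1 ⊆ realIoo x b := fun y hy => ⟨EReal.coe_lt_coe_iff.2 hy.1,
      (by exact_mod_cast hy.2 : (y : EReal) < 1).trans hf.one_lt⟩
    have hsub' : Ioo x 1 ⊆ realIoo x b \ {1} := fun y hy => ⟨hsub hy, hy.2.ne⟩
    have hle : 𝓝[realIoo x b] x ≤ 𝓝[>] x :=
      nhdsWithin_mono _ fun y hy => EReal.coe_lt_coe_iff.1 hy.1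
    refine ⟨(nhdsGT_neBot x).mono (nhdsWithin_Ioo_eq_nhdsGT hx1 ▸ nhdsWithin_mono _ hsub), ?_⟩
    have hm : MonotoneOn (fun y => ((slope f 1 y : ℝ) : EReal)) (Ioo x 1) := fun y hy z hz h =>
      EReal.coe_le_coe_iff.2 (hslope (hsub' hy) (hsub' hz) h)
    exact hf.tendsto_of_tendsto_slope hx1.ne nhdsWithin_le_nhds
      ((hm.tendsto_nhdsWithin_Ioo_right (nonempty_Ioo.2 hx1) (OrderBot.bddBelow _)).mono_left hle)
  · have hx1 : 1 < x := by exact_mod_cast hf.one_lt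
    have hsub : Ioo 1 x ⊆ realIoo a x := fun y hy =>
      ⟨hf.lt_one.trans (by exact_mod_cast hy.1 : (1 : EReal) < y), EReal.coe_lt_coe_iff.2 hy.2⟩
    have hsub' : Ioo 1 x ⊆ realIoo a x \ {1} := fun y hy => ⟨hsub hy, hy.1.ne'⟩
    have hle : 𝓝[realIoo a x] x ≤ 𝓝[<] x :=
      nhdsWithin_mono _ fun y hy => EReal.coe_lt_coe_iff.1 hy.2
    refine ⟨(nhdsLT_neBot x).mono (nhdsWithin_Ioo_eq_nhdsLT hx1 ▸ nhdsWithin_mono _ hsub), ?_⟩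
    have hm : MonotoneOn (fun y => ((slope f 1 y : ℝ) : EReal)) (Ioo 1 x) := fun y hy z hz h =>
      EReal.coe_le_coe_iff.2 (hslope (hsub' hy) (hsub' hz) h)
    exact hf.tendsto_of_tendsto_slope hx1.ne' nhdsWithin_le_nhds
      ((hm.tendsto_nhdsWithin_Ioo_left (nonempty_Ioo.2 hx1) (OrderTop.bddAbove _)).mono_left hle)

/-- Affine minorants of `f` on `(a, b)` are minorants of its extension. -/
theorem le_fExt (hf : IsF1 a b f) {z M : ℝ} (h : ∀ t ∈ realIoo a b, z * t - M ≤ f t) (x : ℝ) :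
    ((z * x - M : ℝ) : EReal) ≤ fExt a b f x := by
  unfold fExt
  split_ifs with h1 h2
  · exact EReal.coe_le_coe_iff.2 (h x h1)
  · obtain ⟨hcl, m, hm⟩ := hf.exists_tendsto h2
    rw [extendFrom_eq hcl hm]
    have := mem_closure_iff_nhdsWithin_neBot.1 hcl
    have hc : Tendsto (fun y : ℝ => ((z * y - M : ℝ) : EReal)) (𝓝[realIoo a b] x)
        (𝓝 ((z * x - M : ℝ) : EReal)) :=
      EReal.tendsto_coe.2 ((Continuous.tendsto (by fun_prop) x).mono_left nhdsWithin_le_nhds)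
    refine le_of_tendsto_of_tendsto hc hm ?_
    filter_upwards [self_mem_nhdsWithin] with y hy
    exact EReal.coe_le_coe_iff.2 (h y hy)
  · exact le_top

/-- Off the open interval the extension differs from ⊤ at no more than two points. -/
theorem measurable_fExt (hf : IsF1 a b f) : Measurable (fExt a b f) := by
  classical
  have hcount : ({x : ℝ | (x : EReal) = a ∨ (x : EReal) = b}).Finite := by
    have : {x : ℝ | (x : EReal) = a ∨ (x : EReal) = b} ⊆ {a.toReal, b.toReal} := by
      rintro x (rfl | rfl) <;> simp
    exact (toFinite _).subset this
  have h1 : Measurable fun x : ℝ => if (x : EReal) = a ∨ (x : EReal) = b then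
      extendFrom (realIoo a b) (fun y : ℝ => (f y : EReal)) x else ⊤ := by
    refine (measurable_const (a := (⊤ : EReal))).measurable_of_countable_ne
      (hcount.countable.mono fun x hx => ?_)
    by_contra h
    exact hx (by simp only [mem_ofPred_eq] at h; simp [h])
  have h2 : fExt a b f = fun x => if x ∈ realIoo a b then (((realIoo a b).indicator f x : ℝ) : EReal)
      else if (x : EReal) = a ∨ (x : EReal) = b then
      extendFrom (realIoo a b) (fun y : ℝ => (f y : EReal)) x else ⊤ := by
    ext x
    by_cases hx : x ∈ realIoo a b <;> simp [fExt, hx]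
  rw [h2]
  exact Measurable.ite (isOpen_realIoo a b).measurableSet hf.measurable_indicator.coe_real_ereal h1

end IsF1

theorem measurable_fConj (a b : EReal) (f : ℝ → ℝ) : Measurable (fConj a b f) := by
  refine EReal.measurable_of_measurable_real (LowerSemicontinuous.measurable ?_)
  simp only [fConj, EReal.coe_ne_top, EReal.coe_ne_bot, or_self, if_false, EReal.toReal_coe]
  exact lowerSemicontinuous_iSup fun x => lowerSemicontinuous_iSup fun _ =>
    (continuous_coe_real_ereal.comp (by fun_prop : Continuous fun z : ℝ => z * x - f x)
      ).lowerSemicontinuous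

/-- Here a ≥ 0 enters: t is positive, so t w - f(t) increases with w. -/
theorem le_fConj (ha : 0 ≤ a) {z : EReal} {t w : ℝ} (ht : t ∈ realIoo a b) (hw : (w : EReal) ≤ z) :
    ((t * w - f t : ℝ) : EReal) ≤ fConj a b f z := by
  induction z with
  | bot => simp at hw
  | top => simp [fConj]
  | coe z =>
    simp only [fConj, EReal.coe_ne_top, EReal.coe_ne_bot, or_self, if_false, EReal.toReal_coe]
    refine le_trans ?_ (le_iSup₂ (f := fun x _ => ((z * x - f x : ℝ) : EReal)) t ht)
    rw [EReal.coe_le_coe_iff] at hw ⊢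
    nlinarith [mul_le_mul_of_nonneg_left hw (pos_of_mem_realIoo ha ht).le]

/-- The strict inequality w < z is what later allows z to be replaced by one term of the supremum
defining the regularized loss. The value z = ⊥ must be excluded, since the conjugate is ⊤ there and
no real lies below ⊥. -/
theorem exists_lt_of_lt_fConj (hf : IsF1 a b f) (ha : 0 ≤ a) {z : EReal} {M : ℝ} (hz : z ≠ ⊥)
    (hM : (M : EReal) < fConj a b f z) :
    ∃ t ∈ realIoo a b, ∃ w : ℝ, (w : EReal) < z ∧ M < t * w - f t := by
  induction z with
  | bot => exact absurd rfl hz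
  | top => exact ⟨1, hf.one_mem, M + 1, EReal.coe_lt_top _, by simp [hf.map_one]⟩
  | coe z =>
    simp only [fConj, EReal.coe_ne_top, EReal.coe_ne_bot, or_self, if_false, EReal.toReal_coe,
      lt_iSup_iff, EReal.coe_lt_coe_iff] at hM
    obtain ⟨t, ht, hM⟩ := hM
    have ht0 := pos_of_mem_realIoo ha ht
    obtain ⟨M', h1, h2⟩ := exists_between hM
    -- This w solves t w - f(t) = M'.
    refine ⟨t, ht, z - (z * t - f t - M') / t, EReal.coe_lt_coe_iff.2 ?_, ?_⟩
    · have : 0 < (z * t - f t - M') / t := div_pos (by linarith) ht0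
      linarith
    · rw [mul_sub, mul_div_cancel₀ _ ht0.ne']
      linarith

/-- The expression whose supremum over `t` and `y` is the dual integrand at `x`. -/
noncomputable def lagr {X : Type*} (f : ℝ → ℝ) (c : X × X → ℝ≥0∞) (L : X → EReal) (l ρ : ℝ)
    (x : X) (t : ℝ) (y : X) : ℝ :=
  t * ((L y).toReal / l - (c (x, y)).toReal - ρ / l) - f t

theorem coe_regLoss_term {L : EReal} (hL : L ≠ ⊤) (hL' : L ≠ ⊥) {c : ℝ≥0∞} (hc : c ≠ ⊤) (l : ℝ) :
    L / (l : EReal) - (c : EReal) = ((L.toReal / l - c.toReal : ℝ) : EReal) := by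
  lift L to ℝ using ⟨hL, hL'⟩
  lift c to NNReal using hc
  rw [EReal.toReal_coe, ENNReal.coe_toReal, EReal.coe_sub, EReal.coe_div]
  rfl

section dualIntegrand

variable {X : Type*} {c : X × X → ℝ≥0∞} {L : X → EReal} {κ lam ρ : ℝ} {x : X}

theorem le_dualIntegrand (ha : 0 ≤ a) {t : ℝ} {y : X} (ht : t ∈ realIoo a b) (hL : L y ≠ ⊤)
    (hL' : L y ≠ ⊥) (hc : c (x, y) ≠ ⊤) :
    (lagr f c L (lam + κ) ρ x t y : EReal) ≤ dualIntegrand a b f c L κ lam ρ x := by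
  refine le_fConj ha ht ?_
  rw [EReal.coe_sub, ← coe_regLoss_term hL hL' hc]
  exact EReal.sub_le_sub (le_iSup (fun y => L y / ((lam + κ : ℝ) : EReal) - (c (x, y) : EReal)) y)
    le_rfl

/-- With `le_dualIntegrand`, this identifies the dual integrand as the supremum of `lagr` over t and
y. The term y = x, where the cost vanishes, keeps the regularized loss above ⊥. -/
theorem exists_lt_lagr (hf : IsF1 a b f) (ha : 0 ≤ a) (hl : 0 < lam + κ) (hLtop : ∀ y, L y ≠ ⊤)
    (hc0 : c (x, x) = 0) (hx : L x ≠ ⊥) {M : ℝ}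
    (hM : (M : EReal) < dualIntegrand a b f c L κ lam ρ x) :
    ∃ t ∈ realIoo a b, ∃ y, L y ≠ ⊥ ∧ c (x, y) ≠ ⊤ ∧ M < lagr f c L (lam + κ) ρ x t y := by
  have hle : (((L x).toReal / (lam + κ) - (c (x, x)).toReal : ℝ) : EReal) ≤
      regLoss c L (lam + κ) x := by
    rw [← coe_regLoss_term (hLtop x) hx (by simp [hc0])]
    exact le_iSup (fun y => L y / ((lam + κ : ℝ) : EReal) - (c (x, y) : EReal)) x
  have hne : regLoss c L (lam + κ) x - ((ρ / (lam + κ) : ℝ) : EReal) ≠ ⊥ := by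
    refine ne_bot_of_le_ne_bot ?_ (EReal.sub_le_sub hle le_rfl)
    rw [← EReal.coe_sub]
    exact EReal.coe_ne_bot _
  obtain ⟨t, ht, w, hw, hMw⟩ := exists_lt_of_lt_fConj hf ha hne hM
  have hw' : ((w + ρ / (lam + κ) : ℝ) : EReal) < regLoss c L (lam + κ) x := by
    rw [EReal.coe_add]
    exact EReal.add_lt_of_lt_sub hw
  obtain ⟨y, hy⟩ := lt_iSup_iff.1 hw'
  have hLy : L y ≠ ⊥ := by
    intro h
    rw [h, EReal.bot_div_of_pos_ne_top (by exact_mod_cast hl) (EReal.coe_ne_top _)] at hy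
    simp at hy
  have hcy : c (x, y) ≠ ⊤ := by
    intro h
    rw [h, EReal.coe_ennreal_top, EReal.sub_top] at hy
    · simp at hy
  refine ⟨t, ht, y, hLy, hcy, ?_⟩
  rw [coe_regLoss_term (hLtop y) hLy hcy, EReal.coe_lt_coe_iff] at hy
  unfold lagr
  have := pos_of_mem_realIoo ha ht
  nlinarith

end dualIntegrand

end convex

/-! ### The dual objective: integrable minorant, measurability, convexity. -/

theorem eint_mono_ae {X : Type*} [MeasurableSpace X] {μ : Measure X} {F G : X → EReal}
    (hFG : ∀ᵐ x ∂μ, F x ≤ G x) : eint μ F ≤ eint μ G := by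
  refine EReal.sub_le_sub (EReal.coe_ennreal_le_coe_ennreal_iff.2 (lintegral_mono_ae ?_))
    (EReal.coe_ennreal_le_coe_ennreal_iff.2 (lintegral_mono_ae ?_))
  · exact hFG.mono fun x hx => EReal.toENNReal_le_toENNReal hx
  · exact hFG.mono fun x hx => EReal.toENNReal_le_toENNReal (EReal.neg_le_neg_iff.2 hx)

section dual

variable {X : Type*} [MeasurableSpace X]
  {a b : EReal} {f : ℝ → ℝ} {c : X × X → ℝ≥0∞} {L : X → EReal} {P : ProbabilityMeasure X}
  {κ lam ρ : ℝ} {h : X → ℝ}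

/-- Test the supremum with t = 1 and y = x. The resulting integrable minorant keeps the dual
objective above -∞. -/
theorem ae_le_dualIntegrand (hf : IsF1 a b f) (ha : 0 ≤ a) (hl : 0 < lam + κ)
    (hLtop : ∀ x, L x ≠ ⊤) (hc0 : ∀ x, c (x, x) = 0)
    (hhL : ∀ᵐ x ∂(P : Measure X), (h x : EReal) ≤ L x) :
    ∀ᵐ x ∂(P : Measure X), ((h x / (lam + κ) - ρ / (lam + κ) : ℝ) : EReal) ≤
      dualIntegrand a b f c L κ lam ρ x := by
  filter_upwards [hhL] with x hx
  have hLb : L x ≠ ⊥ := ne_bot_of_le_ne_bot (EReal.coe_ne_bot _) hx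
  refine le_trans ?_ (le_dualIntegrand ha hf.one_mem (hLtop x) hLb (by simp [hc0]))
  rw [EReal.coe_le_coe_iff, lagr, hc0, hf.map_one]
  have : h x ≤ (L x).toReal := by
    rwa [← EReal.coe_le_coe_iff, EReal.coe_toReal (hLtop x) hLb]
  have := div_le_div_of_nonneg_right this hl.le
  simp only [ENNReal.toReal_zero]
  linarith

end dual

section polish

variable {X : Type*} [TopologicalSpace X] [PolishSpace X] [MeasurableSpace X] [BorelSpace X]
  {a b : EReal} {f : ℝ → ℝ} {c : X × X → ℝ≥0∞} {L : X → EReal} {P : ProbabilityMeasure X}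
  {κ lam ρ ε : ℝ} {h : X → ℝ}

/-- A supremum over uncountably many y need not be Borel, but its superlevel sets are projections of
Borel sets, hence analytic. -/
theorem aemeasurable_regLoss (hL : Measurable L) (hc : LowerSemicontinuous c) (l : ℝ)
    (μ : Measure X) [IsFiniteMeasure μ] : AEMeasurable (regLoss c L l) μ := by
  refine NullMeasurable.aemeasurable ?_
  refine @measurable_of_Ioi _ (NullMeasurableSpace X μ) _ _ _ _ _ _ _ _ fun u => ?_
  refine AnalyticSet.nullMeasurableSet (s := regLoss c L l ⁻¹' Ioi u) ?_ μ
  have heq : regLoss c L l ⁻¹' Ioi u =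
      Prod.fst '' {p : X × X | u < L p.2 / (l : EReal) - (c p : EReal)} := by
    ext x
    simp only [regLoss, mem_preimage, mem_Ioi, lt_iSup_iff, mem_image, mem_ofPred_eq,
      Prod.exists, exists_and_right, exists_eq_right]
  have hm : Measurable fun p : X × X => L p.2 / (l : EReal) - (c p : EReal) := by
    have h1 : Measurable fun p : X × X => L p.2 / (l : EReal) := by
      simp only [EReal.div_eq_inv_mul]
      exact (hL.comp measurable_snd).const_mul _
    have h2 : Measurable fun p : X × X => -(c p : EReal) :=
      continuous_neg.measurable.comp hc.measurable.coe_ereal_ennreal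
    simp only [sub_eq_add_neg]
    exact h1.add h2
  rw [heq]
  exact (measurableSet_lt measurable_const hm).analyticSet.image_of_continuous continuous_fst

theorem aemeasurable_dualIntegrand (hL : Measurable L) (hc : LowerSemicontinuous c)
    (μ : Measure X) [IsFiniteMeasure μ] : AEMeasurable (dualIntegrand a b f c L κ lam ρ) μ := by
  refine (measurable_fConj a b f).comp_aemeasurable ?_
  simp only [sub_eq_add_neg]
  exact (aemeasurable_regLoss hL hc _ μ).add_const _

theorem econvexOn_dualObjective (hL : Measurable L) (hLtop : ∀ x, L x ≠ ⊤)
    (hh : Integrable h (P : Measure X)) (hhL : ∀ᵐ x ∂(P : Measure X), (h x : EReal) ≤ L x)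
    (hf : IsF1 a b f) (ha : 0 ≤ a) (hc : LowerSemicontinuous c) (hc0 : ∀ x, c (x, x) = 0)
    (hκ : 0 ≤ κ) :
    EConvexOn (Ioi (0 : ℝ) ×ˢ (univ : Set ℝ))
      (fun p : ℝ × ℝ => dualObjective a b f c L P ε κ p.1 p.2) := by
  have hminor : ∀ p : ℝ × ℝ, Integrable (fun x => h x / (p.1 + κ) - p.2 / (p.1 + κ))
      (P : Measure X) := fun p => (hh.div_const _).sub (integrable_const _)
  have hbot : ∀ p ∈ Ioi (0 : ℝ) ×ˢ (univ : Set ℝ), ⊥ < dualObjective a b f c L P ε κ p.1 p.2 := by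
    rintro p ⟨hp, -⟩
    have hl : 0 < p.1 + κ := add_pos_of_pos_of_nonneg hp hκ
    have h1 := bot_lt_eint (hminor p) (ae_le_dualIntegrand hf ha hl hLtop hc0 hhL)
    refine EReal.bot_lt_add_iff.2 ⟨EReal.bot_lt_coe _, bot_lt_iff_ne_bot.2 fun h => ?_⟩
    rcases (EReal.mul_eq_bot _ _).1 h with h | h | h | h
    · exact EReal.coe_ne_bot _ h.1
    · exact h1.ne' h.2
    · exact EReal.coe_ne_top _ h.1
    · exact absurd hl (not_lt.2 (by exact_mod_cast h.1.le))
  refine ⟨(convex_Ioi 0).prod convex_univ, hbot, ?_⟩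
  intro p hp q hq s t hs ht hst
  rcases hs.eq_or_lt with rfl | hs
  · obtain rfl : t = 1 := by linarith
    simp
  rcases ht.eq_or_lt with rfl | ht
  · obtain rfl : s = 1 := by linarith
    simp
  have hlp : 0 < p.1 + κ := add_pos_of_pos_of_nonneg hp.1 hκ
  have hlq : 0 < q.1 + κ := add_pos_of_pos_of_nonneg hq.1 hκ
  have hmulbot : ∀ (s : ℝ) (y : EReal), 0 < s → ⊥ < y → (s : EReal) * y ≠ ⊥ := by
    intro s y hs hy h
    rcases (EReal.mul_eq_bot _ _).1 h with h | h | h | h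
    · exact EReal.coe_ne_bot _ h.1
    · exact hy.ne' h.2
    · exact EReal.coe_ne_top _ h.1
    · exact absurd hs (not_lt.2 (by exact_mod_cast h.1.le))
  have htop : ∀ p : ℝ × ℝ, 0 < p.1 + κ →
      eint (P : Measure X) (dualIntegrand a b f c L κ p.1 p.2) = ⊤ →
      dualObjective a b f c L P ε κ p.1 p.2 = ⊤ := by
    intro p hp h
    rw [dualObjective, h, EReal.coe_mul_top_of_pos hp, EReal.coe_add_top]
  by_cases hpt : eint (P : Measure X) (dualIntegrand a b f c L κ p.1 p.2) = ⊤
  · simp only [htop p hlp hpt]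
    rw [EReal.coe_mul_top_of_pos hs, EReal.top_add_of_ne_bot (hmulbot t _ ht (hbot q hq))]
    exact le_top
  by_cases hqt : eint (P : Measure X) (dualIntegrand a b f c L κ q.1 q.2) = ⊤
  · simp only [htop q hlq hqt]
    rw [EReal.coe_mul_top_of_pos ht, EReal.add_top_of_ne_bot (hmulbot s _ hs (hbot p hp))]
    exact le_top
  obtain ⟨hip, hep⟩ := integrable_toReal_of_eint_ne_top (aemeasurable_dualIntegrand hL hc _)
    (hminor p) (ae_le_dualIntegrand hf ha hlp hLtop hc0 hhL) hpt
  obtain ⟨hiq, heq⟩ := integrable_toReal_of_eint_ne_top (aemeasurable_dualIntegrand hL hc _)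
    (hminor q) (ae_le_dualIntegrand hf ha hlq hLtop hc0 hhL) hqt
  set gp := fun x => (dualIntegrand a b f c L κ p.1 p.2 x).toReal
  set gq := fun x => (dualIntegrand a b f c L κ q.1 q.2 x).toReal
  set r := s • p + t • q with hr
  have hr1 : r.1 = s * p.1 + t * q.1 := rfl
  have hr2 : r.2 = s * p.2 + t * q.2 := rfl
  have hlr' : r.1 + κ = s * (p.1 + κ) + t * (q.1 + κ) := by
    rw [hr1]; linear_combination (-κ) * hst
  have hlr : 0 < r.1 + κ := by rw [hlr']; positivity
  -- For fixed x, t and y, l times `lagr` is affine in (lam, ρ), so its supremum, l times the dual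
  -- integrand, is convex.
  have hpt : ∀ᵐ x ∂(P : Measure X), dualIntegrand a b f c L κ r.1 r.2 x ≤
      (((s * (p.1 + κ) * gp x + t * (q.1 + κ) * gq x) / (r.1 + κ) : ℝ) : EReal) := by
    filter_upwards [hep, heq, hhL] with x hxp hxq hx
    have hLb : L x ≠ ⊥ := ne_bot_of_le_ne_bot (EReal.coe_ne_bot _) hx
    refine EReal.ge_of_forall_gt_iff_ge.1 fun M hM => ?_
    obtain ⟨τ, hτ, y, hy, hcy, hMy⟩ := exists_lt_lagr hf ha hlr hLtop (hc0 x) hLb hM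
    have h1 := le_dualIntegrand (f := f) (κ := κ) (lam := p.1) (ρ := p.2) (x := x) ha hτ (hLtop y) hy hcy
    have h2 := le_dualIntegrand (f := f) (κ := κ) (lam := q.1) (ρ := q.2) (x := x) ha hτ (hLtop y) hy hcy
    rw [hxp, EReal.coe_le_coe_iff] at h1
    rw [hxq, EReal.coe_le_coe_iff] at h2
    rw [EReal.coe_le_coe_iff, le_div_iff₀ hlr]
    have key : ∀ l ρ : ℝ, 0 < l → l * lagr f c L l ρ x τ y =
        τ * ((L y).toReal - l * (c (x, y)).toReal - ρ) - l * f τ := by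
      intro l ρ hl
      unfold lagr
      field_simp
    have kp := key (p.1 + κ) p.2 hlp
    have kq := key (q.1 + κ) q.2 hlq
    have kr := key (r.1 + κ) r.2 hlr
    have e1 := mul_le_mul_of_nonneg_left h1 (mul_pos hs hlp).le
    have e2 := mul_le_mul_of_nonneg_left h2 (mul_pos ht hlq).le
    have e3 := mul_le_mul_of_nonneg_left hMy.le hlr.le
    have e4 : (r.1 + κ) * lagr f c L (r.1 + κ) r.2 x τ y =
        s * ((p.1 + κ) * lagr f c L (p.1 + κ) p.2 x τ y) +
          t * ((q.1 + κ) * lagr f c L (q.1 + κ) q.2 x τ y) := by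
      rw [kp, kq, kr, hlr', hr2]
      linear_combination (-τ * (L y).toReal) * hst
    rw [mul_comm M]
    linarith
  have hir := ((hip.const_mul (s * (p.1 + κ))).add (hiq.const_mul (t * (q.1 + κ)))).div_const
    (r.1 + κ)
  have hle := eint_mono_ae hpt
  rw [eint_coe (g := fun x => (s * (p.1 + κ) * gp x + t * (q.1 + κ) * gq x) / (r.1 + κ)) hir,
    integral_div, integral_add (hip.const_mul _) (hiq.const_mul _), integral_const_mul,
    integral_const_mul] at hle
  change dualObjective a b f c L P ε κ r.1 r.2 ≤ (s : EReal) * dualObjective a b f c L P ε κ p.1 p.2 +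
    (t : EReal) * dualObjective a b f c L P ε κ q.1 q.2
  unfold dualObjective
  rw [eint_eq_integral hip hep, eint_eq_integral hiq heq]
  refine (add_le_add_right (mul_le_mul_of_nonneg_left hle (by exact_mod_cast hlr.le)) _).trans ?_
  norm_cast
  rw [mul_div_cancel₀ _ hlr.ne', hr1, hr2]
  apply le_of_eq
  ring

end polish

/-! ### Weak duality. -/

section weak

variable {X : Type*} [MeasurableSpace X] {a b : EReal} {f : ℝ → ℝ}

theorem eint_map {Y : Type*} [MeasurableSpace Y] {μ : Measure Y} {p : Y → X} (hp : Measurable p)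
    {F : X → EReal} (hF : Measurable F) : eint (μ.map p) F = eint μ (F ∘ p) := by
  have hF' : Measurable fun x => -F x := continuous_neg.measurable.comp hF
  unfold eint
  rw [lintegral_map hF.ereal_toENNReal hp, lintegral_map hF'.ereal_toENNReal hp]
  rfl

theorem integrable_density (η P : ProbabilityMeasure X) :
    Integrable (fun x => ((η : Measure X).rnDeriv (P : Measure X) x).toReal) (P : Measure X) :=
  Measure.integrable_toReal_rnDeriv

theorem integral_density {η P : ProbabilityMeasure X} (hac : (η : Measure X) ≪ (P : Measure X)) :
    ∫ x, ((η : Measure X).rnDeriv (P : Measure X) x).toReal ∂(P : Measure X) = 1 := by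
  rw [Measure.integral_toReal_rnDeriv hac, probReal_univ]

/-- If the divergence is finite, it is the integral of an integrable real function. -/
theorem fDiv_eq_integral (hf : IsF1 a b f) {η P : ProbabilityMeasure X} (h : fDiv a b f η P ≠ ⊤) :
    (η : Measure X) ≪ (P : Measure X) ∧ ∃ u : X → ℝ, Integrable u (P : Measure X) ∧
      (∀ᵐ x ∂(P : Measure X),
        fExt a b f (((η : Measure X).rnDeriv (P : Measure X) x).toReal) = (u x : EReal)) ∧
      fDiv a b f η P = ((∫ x, u x ∂(P : Measure X) : ℝ) : EReal) := by
  by_cases hac : (η : Measure X) ≪ (P : Measure X)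
  · rw [fDiv, if_pos hac] at h ⊢
    obtain ⟨s, hs⟩ := hf.exists_subgradient
    have hF : Measurable fun x =>
        fExt a b f (((η : Measure X).rnDeriv (P : Measure X) x).toReal) :=
      hf.measurable_fExt.comp (Measure.measurable_rnDeriv _ _).ennreal_toReal
    obtain ⟨h1, h2⟩ := integrable_toReal_of_eint_ne_top hF.aemeasurable
      (((integrable_density η P).const_mul s).sub (integrable_const s))
      (ae_of_all _ fun x => hf.le_fExt (fun t ht => by linarith [hs t ht]) _) h
    exact ⟨hac, _, h1, h2, eint_eq_integral h1 h2⟩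
  · exact absurd (if_neg hac) h

/-- Integrate the supporting line s (φ - 1) of f at 1; its integral is 0 because the density φ has
mass 1. -/
theorem fDiv_nonneg (hf : IsF1 a b f) (η P : ProbabilityMeasure X) : 0 ≤ fDiv a b f η P := by
  by_cases h : fDiv a b f η P = ⊤
  · rw [h]; exact le_top
  obtain ⟨hac, u, hu, hue, hD⟩ := fDiv_eq_integral hf h
  obtain ⟨s, hs⟩ := hf.exists_subgradient
  have hi := integrable_density η P
  have hle : ∫ x, (s * ((η : Measure X).rnDeriv (P : Measure X) x).toReal - s) ∂(P : Measure X) ≤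
      ∫ x, u x ∂(P : Measure X) := by
    refine integral_mono_ae ((hi.const_mul s).sub (integrable_const s)) hu ?_
    filter_upwards [hue] with x hx
    rw [← EReal.coe_le_coe_iff, ← hx]
    exact hf.le_fExt (fun t ht => by linarith [hs t ht]) _
  rw [integral_sub (hi.const_mul s) (integrable_const s), integral_const_mul,
    integral_density hac] at hle
  rw [hD]
  have : 0 ≤ ∫ x, u x ∂(P : Measure X) := by simpa using hle
  exact_mod_cast this

theorem otDiv_nonneg (hf : IsF1 a b f) (c : X × X → ℝ≥0∞) (Q P : ProbabilityMeasure X) :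
    0 ≤ otDiv (fDiv a b f) c Q P :=
  le_iInf fun η => add_nonneg (fDiv_nonneg hf η P) (EReal.coe_ennreal_nonneg _)

/-- Young's inequality along a coupling whose first marginal has finite divergence. -/
theorem eint_le_of_coupling (hf : IsF1 a b f) {c : X × X → ℝ≥0∞} (hcm : Measurable c)
    {L : X → EReal} (hL : Measurable L) (hLtop : ∀ x, L x ≠ ⊤) {κ lam ρ : ℝ} (hl : 0 < lam + κ)
    {P η Q : ProbabilityMeasure X} {π : ProbabilityMeasure (X × X)}
    (h1 : (π : Measure (X × X)).map Prod.fst = (η : Measure X))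
    (h2 : (π : Measure (X × X)).map Prod.snd = (Q : Measure X))
    (hR : AEMeasurable (regLoss c L (lam + κ)) (P : Measure X))
    {G : X → ℝ} (hG : Integrable G (P : Measure X))
    (hFG : dualIntegrand a b f c L κ lam ρ =ᵐ[(P : Measure X)] fun x => (G x : EReal))
    (hD : fDiv a b f η P ≠ ⊤) (hπc : ∫⁻ p, c p ∂(π : Measure (X × X)) ≠ ⊤) :
    eint (Q : Measure X) L ≤ (((lam + κ) * ((fDiv a b f η P).toReal +
      (∫⁻ p, c p ∂(π : Measure (X × X))).toReal + ∫ x, G x ∂(P : Measure X)) + ρ : ℝ) : EReal) := by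
  obtain ⟨hac, u, hu, hue, hDu⟩ := fDiv_eq_integral hf hD
  set l := lam + κ with hldef
  set φ : X → ℝ := fun x => ((η : Measure X).rnDeriv (P : Measure X) x).toReal with hφ
  have hφi : Integrable φ (P : Measure X) := integrable_density η P
  have hφ0 : ∀ x, 0 ≤ φ x := fun x => ENNReal.toReal_nonneg
  set g : X → ℝ := fun x => (regLoss c L l x).toReal with hg
  have hgm : AEMeasurable g (P : Measure X) := hR.ereal_toReal
  -- The convention f*(±∞) = ∞ makes the regularized loss finite wherever the dual integrand is.
  have hreg : ∀ᵐ x ∂(P : Measure X), regLoss c L l x = (g x : EReal) := by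
    filter_upwards [hFG] with x hx
    refine (EReal.coe_toReal ?_ ?_).symm <;> intro h <;>
      simp [dualIntegrand, ← hldef, h, fConj] at hx
  have hU : ∀ᵐ x ∂(P : Measure X), φ x * g x ≤ G x + u x + ρ / l * φ x := by
    filter_upwards [hFG, hue, hreg] with x hx hux hgx
    have hsub : ∀ t ∈ realIoo a b, (g x - ρ / l) * t - G x ≤ f t := by
      intro t ht
      have h3 : ((t * (g x - ρ / l) - f t : ℝ) : EReal) ≤ (G x : EReal) := by
        rw [← hx, dualIntegrand, ← hldef, hgx, ← EReal.coe_sub]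
        rw [fConj, if_neg (not_or.2 ⟨EReal.coe_ne_top _, EReal.coe_ne_bot _⟩)]
        rw [mul_comm]
        exact le_iSup₂ (f := fun s _ =>
          (((((g x - ρ / l : ℝ) : EReal).toReal) * s - f s : ℝ) : EReal)) t ht
      rw [EReal.coe_le_coe_iff] at h3
      linarith
    have h4 := hf.le_fExt hsub (φ x)
    rw [hux, EReal.coe_le_coe_iff] at h4
    linarith
  have hUi : Integrable (fun x => G x + u x + ρ / l * φ x) (P : Measure X) :=
    (hG.add hu).add (hφi.const_mul _)
  rw [← h2, eint_map measurable_snd hL]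
  -- Integrability is bootstrapped: if the negative part of L has infinite integral, the left side
  -- is ⊥ by convention. Otherwise Young bounds the positive part of g under η, this bounds that of
  -- L under π, and then L / l - c bounds g from below.
  by_cases hneg : ∫⁻ p, (-(L ∘ Prod.snd) p).toENNReal ∂(π : Measure (X × X)) = ⊤
  · have : eint (π : Measure (X × X)) (L ∘ Prod.snd) = ⊥ := by
      rw [eint, hneg, EReal.coe_ennreal_top, EReal.sub_top]
    rw [this]
    exact bot_le
  have hregη : ∀ᵐ x ∂(η : Measure X), regLoss c L l x = (g x : EReal) := hac.ae_le hreg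
  have hctop : ∀ᵐ p ∂(π : Measure (X × X)), c p < ⊤ := ae_lt_top hcm hπc
  have hci : Integrable (fun p => (c p).toReal) (π : Measure (X × X)) :=
    integrable_toReal_of_lintegral_ne_top hcm.aemeasurable hπc
  have hptw : ∀ᵐ p ∂(π : Measure (X × X)),
      L p.2 ≤ ((l * ((c p).toReal + g p.1) : ℝ) : EReal) := by
    rw [← h1] at hregη
    filter_upwards [hctop, ae_of_ae_map measurable_fst.aemeasurable hregη] with p hcp hgp
    by_cases hLp : L p.2 = ⊥
    · rw [hLp]; exact bot_le
    have h5 : ((((L p.2).toReal / l - (c p).toReal : ℝ)) : EReal) ≤ (g p.1 : EReal) := by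
      rw [← coe_regLoss_term (hLtop _) hLp hcp.ne, ← hgp]
      exact le_iSup (fun y => L y / (l : EReal) - (c (p.1, y) : EReal)) p.2
    rw [EReal.coe_le_coe_iff, sub_le_iff_le_add, div_le_iff₀ hl] at h5
    rw [← EReal.coe_toReal (hLtop _) hLp, EReal.coe_le_coe_iff]
    linarith
  have hgη : AEMeasurable g (η : Measure X) := hgm.mono_ac hac
  have hgpos : ∫⁻ x, ENNReal.ofReal (g x) ∂(η : Measure X) ≠ ⊤ := by
    rw [← lintegral_rnDeriv_mul hac hgm.ennreal_ofReal]
    refine ((lintegral_mono_ae ?_).trans_lt hUi.lintegral_lt_top).ne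
    filter_upwards [hU, Measure.rnDeriv_lt_top (η : Measure X) (P : Measure X)] with x hx hlt
    rw [← ENNReal.ofReal_toReal hlt.ne, ← ENNReal.ofReal_mul (hφ0 x)]
    exact ENNReal.ofReal_le_ofReal hx
  have hgposi : Integrable (fun x => max (g x) 0) (η : Measure X) := by
    have := integrable_toReal_of_lintegral_ne_top hgη.ennreal_ofReal hgpos
    simpa only [ENNReal.toReal_ofReal'] using this
  have hcomp : ∀ {w : X → ℝ}, Integrable w (η : Measure X) →
      Integrable (fun p : X × X => w p.1) (π : Measure (X × X)) := by
    intro w hw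
    rw [← h1] at hw
    exact hw.comp_measurable measurable_fst
  have hLpos : ∫⁻ p, ((L ∘ Prod.snd) p).toENNReal ∂(π : Measure (X × X)) ≠ ⊤ := by
    refine ((lintegral_mono_ae ?_).trans_lt
      ((hci.add (hcomp hgposi)).const_mul l).lintegral_lt_top).ne
    filter_upwards [hptw] with p hp
    rw [← EReal.real_coe_toENNReal]
    refine EReal.toENNReal_le_toENNReal (hp.trans (EReal.coe_le_coe_iff.2 ?_))
    exact mul_le_mul_of_nonneg_left (add_le_add le_rfl (le_max_left _ _)) hl.le
  obtain ⟨hLi, hLe⟩ := integrable_toReal (hL.comp measurable_snd).aemeasurable hLpos hneg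
  have hptr : ∀ᵐ p ∂(π : Measure (X × X)), ((L ∘ Prod.snd) p).toReal ≤
      l * ((c p).toReal + g p.1) := by
    filter_upwards [hptw, hLe] with p hp hpe
    rw [← EReal.coe_le_coe_iff, ← hpe]
    exact hp
  have hgπm : AEStronglyMeasurable (fun p : X × X => g p.1) (π : Measure (X × X)) := by
    have : AEMeasurable g ((π : Measure (X × X)).map Prod.fst) := by rwa [h1]
    exact (this.comp_measurable measurable_fst).aestronglyMeasurable
  have hgπ : Integrable (fun p : X × X => g p.1) (π : Measure (X × X)) := by
    refine integrable_of_le_of_le hgπm (g₁ := fun p => ((L ∘ Prod.snd) p).toReal / l - (c p).toReal)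
      ?_ (ae_of_all _ fun p => le_max_left (g p.1) 0) ((hLi.div_const _).sub hci) (hcomp hgposi)
    filter_upwards [hptr] with p hp
    rw [sub_le_iff_le_add, div_le_iff₀ hl]
    linarith
  have hgηi : Integrable g (η : Measure X) := by
    rw [← h1, integrable_map_measure (by rw [h1]; exact hgη.aestronglyMeasurable)
      measurable_fst.aemeasurable]
    exact hgπ
  have hint_g : ∫ p, g p.1 ∂(π : Measure (X × X)) = ∫ x, g x ∂(η : Measure X) := by
    rw [← h1, integral_map measurable_fst.aemeasurable
      (by rw [h1]; exact hgη.aestronglyMeasurable)]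
  have hle1 := integral_mono_ae hLi ((hci.add hgπ).const_mul l) hptr
  have hle2 : ∫ x, g x ∂(η : Measure X) ≤ ∫ x, (G x + u x + ρ / l * φ x) ∂(P : Measure X) := by
    rw [← integral_rnDeriv_smul hac]
    exact integral_mono_ae ((integrable_rnDeriv_smul_iff hac).2 hgηi) hUi hU
  have hGu : Integrable (fun x => G x + u x) (P : Measure X) := hG.add hu
  rw [integral_add hGu (hφi.const_mul _), integral_add hG hu, integral_const_mul,
    integral_density hac] at hle2
  simp only [Pi.add_apply] at hle1
  rw [integral_const_mul, integral_add hci hgπ, hint_g, integral_toReal hcm.aemeasurable hctop]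
    at hle1
  rw [eint_eq_integral hLi hLe, EReal.coe_le_coe_iff, hDu, EReal.toReal_coe]
  refine hle1.trans ?_
  have h6 := mul_le_mul_of_nonneg_left hle2 hl.le
  have h7 : l * (ρ / l * 1) = ρ := by field_simp
  nlinarith

theorem weak_duality (hf : IsF1 a b f) {c : X × X → ℝ≥0∞} (hcm : Measurable c)
    {L : X → EReal} (hL : Measurable L) (hLtop : ∀ x, L x ≠ ⊤) {κ lam ρ ε : ℝ} (hl : 0 < lam)
    (hκ : 0 ≤ κ) {P Q : ProbabilityMeasure X}
    (hR : AEMeasurable (regLoss c L (lam + κ)) (P : Measure X))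
    {h : X → ℝ} (hh : Integrable h (P : Measure X))
    (hhF : ∀ᵐ x ∂(P : Measure X), (h x : EReal) ≤ dualIntegrand a b f c L κ lam ρ x)
    (hQ : otDiv (fDiv a b f) c Q P ≤ (ε : EReal)) :
    eint (Q : Measure X) L - (κ : EReal) * otDiv (fDiv a b f) c Q P ≤
      dualObjective a b f c L P ε κ lam ρ := by
  have hl' : 0 < lam + κ := by positivity
  by_cases ht : eint (P : Measure X) (dualIntegrand a b f c L κ lam ρ) = ⊤
  · rw [dualObjective, ht, EReal.coe_mul_top_of_pos hl', EReal.coe_add_top]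
    exact le_top
  have hFm : AEMeasurable (dualIntegrand a b f c L κ lam ρ) (P : Measure X) := by
    refine (measurable_fConj a b f).comp_aemeasurable ?_
    simp only [sub_eq_add_neg]
    exact hR.add_const _
  obtain ⟨hGi, hFG⟩ := integrable_toReal_of_eint_ne_top hFm hh hhF ht
  rw [dualObjective, eint_eq_integral hGi hFG]
  set I := ∫ x, (dualIntegrand a b f c L κ lam ρ x).toReal ∂(P : Measure X)
  have hD0 := otDiv_nonneg hf c Q P
  obtain ⟨d, hd⟩ : ∃ d : ℝ, otDiv (fDiv a b f) c Q P = (d : EReal) :=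
    ⟨_, (EReal.coe_toReal (ne_top_of_le_ne_top (EReal.coe_ne_top _) hQ)
      (ne_bot_of_le_ne_bot EReal.zero_ne_bot hD0)).symm⟩
  rw [hd, EReal.coe_le_coe_iff] at hQ
  -- The slack δ is needed because the infima over η and over couplings need not be attained.
  have hmain : ∀ δ : ℝ, 0 < δ →
      eint (Q : Measure X) L ≤ (((lam + κ) * (d + δ + I) + ρ : ℝ) : EReal) := by
    intro δ hδ
    have hlt : otDiv (fDiv a b f) c Q P < ((d + δ : ℝ) : EReal) := by
      rw [hd, EReal.coe_lt_coe_iff]; linarith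
    obtain ⟨η, hη⟩ := iInf_lt_iff.1 hlt
    have hDη : fDiv a b f η P ≠ ⊤ := by
      intro h
      rw [h, EReal.top_add_of_ne_bot (EReal.coe_ennreal_ne_bot _)] at hη
      exact not_top_lt hη
    obtain ⟨r, hr⟩ : ∃ r : ℝ, fDiv a b f η P = (r : EReal) :=
      ⟨_, (EReal.coe_toReal hDη (ne_bot_of_le_ne_bot EReal.zero_ne_bot (fDiv_nonneg hf η P))).symm⟩
    have hC : otCost c η Q < ENNReal.ofReal (d + δ - r) := by
      rw [hr, add_comm] at hη
      have h3 : (otCost c η Q : EReal) < ((d + δ - r : ℝ) : EReal) := by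
        rw [EReal.coe_sub]
        exact EReal.lt_sub_iff_add_lt (Or.inl (EReal.coe_ne_bot _)) (Or.inl (EReal.coe_ne_top _)) |>.2 hη
      have h4 : (0 : EReal) ≤ ((d + δ - r : ℝ) : EReal) := (EReal.coe_ennreal_nonneg _).trans h3.le
      rw [← EReal.coe_ennreal_lt_coe_ennreal_iff]
      rw [← EReal.real_coe_toENNReal, EReal.coe_toENNReal h4]
      exact h3
    obtain ⟨π, hπ⟩ := iInf_lt_iff.1 hC
    obtain ⟨⟨h1, h2⟩, hπ⟩ := iInf_lt_iff.1 hπ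
    have hπtop := (hπ.trans ENNReal.ofReal_lt_top).ne
    refine (eint_le_of_coupling hf hcm hL hLtop hl' h1 h2 hR hGi hFG hDη hπtop).trans
      (EReal.coe_le_coe_iff.2 ?_)
    rw [hr, EReal.toReal_coe]
    have h5 := ENNReal.lt_ofReal_iff_toReal_lt hπtop |>.1 hπ
    have h6 := mul_le_mul_of_nonneg_left (show r + (∫⁻ p, c p ∂(π : Measure (X × X))).toReal + I ≤
      d + δ + I by linarith) hl'.le
    linarith
  rw [hd]
  generalize eint (Q : Measure X) L = E at hmain
  norm_cast
  induction E with
  | bot => simp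
  | top => exact absurd (top_le_iff.1 (hmain 1 one_pos)) (EReal.coe_ne_top _)
  | coe E =>
    norm_cast
    refine le_of_forall_pos_le_add fun δ hδ => ?_
    have h7 := EReal.coe_le_coe_iff.1 (hmain (δ / (lam + κ)) (by positivity))
    have h8 : (lam + κ) * (δ / (lam + κ)) = δ := by field_simp
    nlinarith [mul_le_mul_of_nonneg_left hQ hl.le]

end weak

/-! ### Finite-dimensional separation. -/

/-- Lagrange multipliers for a convex set of triples (mass, cost, value) that satisfies Slater's
condition and whose projection to the masses is a neighbourhood of `1`. -/
theorem exists_multipliers {W : Set (ℝ × ℝ × ℝ)} (hW : Convex ℝ W) {ε v₀ r D V V₁ d₀ : ℝ}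
    (hp : ((1 : ℝ), ε, v₀) ∉ W) (hr : 0 < r)
    (hnear : ∀ m d v, |m - 1| < r → D < d → v ≤ V → (m, d, v) ∈ W)
    (hd₀ : d₀ < ε) (hslater : ∀ v ≤ V₁, ((1 : ℝ), d₀, v) ∈ W) :
    ∃ lam ρ : ℝ, 0 ≤ lam ∧ ∀ w ∈ W, w.2.2 - lam * (w.2.1 - ε) - ρ * (w.1 - 1) ≤ v₀ := by
  have hO : IsOpen {w : ℝ × ℝ × ℝ | |w.1 - 1| < r ∧ D < w.2.1 ∧ w.2.2 < V} :=
    (isOpen_lt (f := fun w : ℝ × ℝ × ℝ => |w.1 - 1|) (by fun_prop) continuous_const).inter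
      ((isOpen_lt (g := fun w : ℝ × ℝ × ℝ => w.2.1) continuous_const (by fun_prop)).inter
        (isOpen_lt (f := fun w : ℝ × ℝ × ℝ => w.2.2) (by fun_prop) continuous_const))
  have hOW : {w : ℝ × ℝ × ℝ | |w.1 - 1| < r ∧ D < w.2.1 ∧ w.2.2 < V} ⊆ W :=
    fun w hw => hnear w.1 w.2.1 w.2.2 hw.1 hw.2.1 hw.2.2.le
  have hmemO : ((1 : ℝ), D + 1, V - 1) ∈ interior W :=
    interior_maximal hOW hO (by simpa using hr)
  obtain ⟨g, hg⟩ := geometric_hahn_banach_open_point hW.interior isOpen_interior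
    (fun h => hp (interior_subset h))
  have hgW : ∀ w ∈ W, g w ≤ g (1, ε, v₀) := by
    have hcl : closure (interior W) ⊆ {w | g w ≤ g (1, ε, v₀)} :=
      closure_minimal (fun w hw => (hg w hw).le) (isClosed_le g.continuous continuous_const)
    intro w hw
    refine hcl ?_
    rw [hW.closure_interior_eq_closure_of_nonempty_interior ⟨_, hmemO⟩]
    exact subset_closure hw
  obtain ⟨α, β, γ, hgeq⟩ : ∃ α β γ : ℝ, ∀ m d v : ℝ, g (m, d, v) = α * m + β * d + γ * v := by
    refine ⟨g (1, 0, 0), g (0, 1, 0), g (0, 0, 1), fun m d v => ?_⟩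
    have : (m, d, v) = m • ((1 : ℝ), (0 : ℝ), (0 : ℝ)) + d • ((0 : ℝ), (1 : ℝ), (0 : ℝ)) +
        v • ((0 : ℝ), (0 : ℝ), (1 : ℝ)) := by simp
    rw [this, map_add, map_add, map_smul, map_smul, map_smul, smul_eq_mul, smul_eq_mul, smul_eq_mul]
    ring
  have hle : ∀ m d v, (m, d, v) ∈ W → α * m + β * d + γ * v ≤ α + β * ε + γ * v₀ := by
    intro m d v h
    have := hgW _ h
    rw [hgeq, hgeq] at this
    linarith
  have hlarge : ∀ u K : ℝ, (∀ n : ℕ, u * n ≤ K) → u ≤ 0 := by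
    intro u K h
    by_contra! hu
    obtain ⟨n, hn⟩ := exists_nat_gt (K / u)
    rw [div_lt_iff₀ hu] at hn
    linarith [h n]
  -- The value may decrease and the cost increase without leaving W, which fixes the signs of γ and
  -- β.
  have hγ : 0 ≤ γ := by
    rw [← neg_nonpos]
    refine hlarge _ (α + β * ε + γ * v₀ - α - β * d₀ - γ * V₁) fun n => ?_
    have := hle 1 d₀ (V₁ - n) (hslater _ (by linarith [n.cast_nonneg (α := ℝ)]))
    linarith
  have hβ : β ≤ 0 := by
    refine hlarge _ (α + β * ε + γ * v₀ - α - β * (D + 1) - γ * V) fun n => ?_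
    have := hle 1 (D + 1 + n) V (hnear _ _ _ (by simpa using hr)
      (by linarith [n.cast_nonneg (α := ℝ)]) le_rfl)
    linarith
  -- If γ = 0, the Slater point forces β = 0, and masses on both sides of 1 force α = 0. The
  -- functional then vanishes, against strict separation from the interior.
  have hγ' : 0 < γ := by
    refine hγ.lt_of_ne fun h0 => ?_
    have h1 := hle 1 d₀ V₁ (hslater _ le_rfl)
    have hβ0 : β = 0 := by
      rw [← h0] at h1
      nlinarith
    have h2 := hle (1 + r / 2) (D + 1) V (hnear _ _ _
      (by rw [add_sub_cancel_left, abs_of_pos] <;> linarith) (by linarith) le_rfl)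
    have h3 := hle (1 - r / 2) (D + 1) V (hnear _ _ _
      (by rw [sub_sub_cancel_left, abs_neg, abs_of_pos] <;> linarith) (by linarith) le_rfl)
    have h4 := hg _ hmemO
    rw [hgeq, hgeq] at h4
    rw [hβ0, ← h0] at h2 h3 h4
    nlinarith
  refine ⟨-β / γ, -α / γ, div_nonneg (by linarith) hγ, fun w hw => ?_⟩
  have h1 := hle w.1 w.2.1 w.2.2 hw
  have h2 : γ * (w.2.2 - -β / γ * (w.2.1 - ε) - -α / γ * (w.1 - 1)) =
      γ * w.2.2 + β * (w.2.1 - ε) + α * (w.1 - 1) := by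
    field_simp
    ring
  refine le_of_mul_le_mul_left ?_ hγ'
  rw [h2]
  linarith

/-! ### Unnormalized transport plans. -/

section plans

variable {X : Type*} [MeasurableSpace X] {a b : EReal} {f : ℝ → ℝ} {c : X × X → ℝ≥0∞}
  {L : X → EReal} {P : ProbabilityMeasure X} {κ : ℝ}

/-- A transport plan `π` of finite cost whose first marginal has the density `φ` with respect
to `P`; the density takes values in `(a, b)` and its mass is not normalized. -/
structure IsPlan (a b : EReal) (f : ℝ → ℝ) (c : X × X → ℝ≥0∞) (L : X → EReal)
    (P : ProbabilityMeasure X) (π : Measure (X × X)) (φ : X → ℝ) : Prop where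
  measurable : Measurable φ
  mem : ∀ x, φ x ∈ realIoo a b
  integrable : Integrable φ (P : Measure X)
  integrable_comp : Integrable (fun x => f (φ x)) (P : Measure X)
  map_fst : π.map Prod.fst = (P : Measure X).withDensity fun x => ENNReal.ofReal (φ x)
  cost_ne_top : ∫⁻ p, c p ∂π ≠ ⊤
  integrable_loss : Integrable (fun p => (L p.2).toReal) π
  ae_ne_bot : ∀ᵐ p ∂π, L p.2 ≠ ⊥

/-- The divergence of the first marginal plus the transport cost. -/
noncomputable def planCost (f : ℝ → ℝ) (c : X × X → ℝ≥0∞) (P : ProbabilityMeasure X)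
    (π : Measure (X × X)) (φ : X → ℝ) : ℝ :=
  ∫ x, f (φ x) ∂(P : Measure X) + (∫⁻ p, c p ∂π).toReal

/-- The triples (mass, cost, value) that are dominated by a plan. -/
def attainable (a b : EReal) (f : ℝ → ℝ) (c : X × X → ℝ≥0∞) (L : X → EReal)
    (P : ProbabilityMeasure X) (κ : ℝ) : Set (ℝ × ℝ × ℝ) :=
  {w | ∃ (π : Measure (X × X)) (φ : X → ℝ), IsPlan a b f c L P π φ ∧
    w.1 = ∫ x, φ x ∂(P : Measure X) ∧ planCost f c P π φ ≤ w.2.1 ∧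
    w.2.2 ≤ ∫ p, (L p.2).toReal ∂π - κ * planCost f c P π φ}

/-- Mass, transport cost and expected loss are linear under mixing of plans; only f is nonlinear.
Its convexity gives inequalities in the direction allowed by domination, κ ≥ 0 being needed for the
value. -/
theorem convex_attainable (hf : IsF1 a b f) (ha : 0 ≤ a) (hκ : 0 ≤ κ) :
    Convex ℝ (attainable a b f c L P κ) := by
  rintro w₁ ⟨π₁, φ₁, h₁, hm₁, hd₁, hv₁⟩ w₂ ⟨π₂, φ₂, h₂, hm₂, hd₂, hv₂⟩ s t hs ht hst
  have hmem : ∀ x, s * φ₁ x + t * φ₂ x ∈ realIoo a b := fun x =>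
    hf.convexOn.1 (h₁.mem x) (h₂.mem x) hs ht hst
  have hfle : ∀ x, f (s * φ₁ x + t * φ₂ x) ≤ s * f (φ₁ x) + t * f (φ₂ x) := fun x =>
    hf.convexOn.2 (h₁.mem x) (h₂.mem x) hs ht hst
  have hφm : Measurable fun x => s * φ₁ x + t * φ₂ x :=
    (h₁.measurable.const_mul s).add (h₂.measurable.const_mul t)
  have hφi : Integrable (fun x => s * φ₁ x + t * φ₂ x) (P : Measure X) :=
    (h₁.integrable.const_mul s).add (h₂.integrable.const_mul t)
  have hfi₂ : Integrable (fun x => s * f (φ₁ x) + t * f (φ₂ x)) (P : Measure X) :=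
    (h₁.integrable_comp.const_mul s).add (h₂.integrable_comp.const_mul t)
  obtain ⟨z, hz⟩ := hf.exists_subgradient
  -- The supporting line bounds f of the mixture from below, convexity from above.
  have hfi : Integrable (fun x => f (s * φ₁ x + t * φ₂ x)) (P : Measure X) :=
    integrable_of_le_of_le (hf.measurable_comp hφm hmem).aestronglyMeasurable
      (ae_of_all _ fun x => hz _ (hmem x)) (ae_of_all _ hfle)
      ((hφi.sub (integrable_const 1)).const_mul z) hfi₂
  have hcost : ∫⁻ p, c p ∂(ENNReal.ofReal s • π₁ + ENNReal.ofReal t • π₂) =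
      ENNReal.ofReal s * ∫⁻ p, c p ∂π₁ + ENNReal.ofReal t * ∫⁻ p, c p ∂π₂ := by
    rw [lintegral_add_measure, lintegral_smul_measure, lintegral_smul_measure, smul_eq_mul,
      smul_eq_mul]
  have hL₁ := h₁.integrable_loss.smul_measure (ENNReal.ofReal_ne_top (r := s))
  have hL₂ := h₂.integrable_loss.smul_measure (ENNReal.ofReal_ne_top (r := t))
  have hplan : IsPlan a b f c L P (ENNReal.ofReal s • π₁ + ENNReal.ofReal t • π₂)
      (fun x => s * φ₁ x + t * φ₂ x) := by
    refine ⟨hφm, hmem, hφi, hfi, ?_, ?_, hL₁.add_measure hL₂, ?_⟩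
    · rw [Measure.map_add _ _ measurable_fst, Measure.map_smul, Measure.map_smul, h₁.map_fst,
        h₂.map_fst, ← withDensity_smul _ h₁.measurable.ennreal_ofReal,
        ← withDensity_smul _ h₂.measurable.ennreal_ofReal,
        ← withDensity_add_left (h₁.measurable.ennreal_ofReal.const_smul _)]
      congr 1
      ext x
      have p1 := (pos_of_mem_realIoo ha (h₁.mem x)).le
      have p2 := (pos_of_mem_realIoo ha (h₂.mem x)).le
      rw [ENNReal.ofReal_add (by positivity) (by positivity), ENNReal.ofReal_mul hs,
        ENNReal.ofReal_mul ht]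
      rfl
    · rw [hcost]
      exact ENNReal.add_ne_top.2 ⟨ENNReal.mul_ne_top ENNReal.ofReal_ne_top h₁.cost_ne_top,
        ENNReal.mul_ne_top ENNReal.ofReal_ne_top h₂.cost_ne_top⟩
    · rw [ae_add_measure_iff]
      exact ⟨Measure.ae_smul_measure h₁.ae_ne_bot _, Measure.ae_smul_measure h₂.ae_ne_bot _⟩
  have hpc : planCost f c P (ENNReal.ofReal s • π₁ + ENNReal.ofReal t • π₂)
      (fun x => s * φ₁ x + t * φ₂ x) ≤ s * planCost f c P π₁ φ₁ + t * planCost f c P π₂ φ₂ := by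
    have h3 := integral_mono hfi hfi₂ hfle
    rw [integral_add (h₁.integrable_comp.const_mul s) (h₂.integrable_comp.const_mul t),
      integral_const_mul, integral_const_mul] at h3
    unfold planCost
    rw [hcost, ENNReal.toReal_add (ENNReal.mul_ne_top ENNReal.ofReal_ne_top h₁.cost_ne_top)
      (ENNReal.mul_ne_top ENNReal.ofReal_ne_top h₂.cost_ne_top), ENNReal.toReal_mul,
      ENNReal.toReal_mul, ENNReal.toReal_ofReal hs, ENNReal.toReal_ofReal ht]
    linarith
  refine ⟨_, _, hplan, ?_, hpc.trans ?_, ?_⟩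
  · rw [integral_add (h₁.integrable.const_mul s) (h₂.integrable.const_mul t),
      integral_const_mul, integral_const_mul, ← hm₁, ← hm₂]
    rfl
  · exact add_le_add (mul_le_mul_of_nonneg_left hd₁ hs) (mul_le_mul_of_nonneg_left hd₂ ht)
  · rw [integral_add_measure hL₁ hL₂, integral_smul_measure, integral_smul_measure,
      ENNReal.toReal_ofReal hs, ENNReal.toReal_ofReal ht, smul_eq_mul, smul_eq_mul]
    have e1 := mul_le_mul_of_nonneg_left hpc hκ
    have e2 := mul_le_mul_of_nonneg_left hv₁ hs
    have e3 := mul_le_mul_of_nonneg_left hv₂ ht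
    change s * w₁.2.2 + t * w₂.2.2 ≤ _
    linarith

/-- Normalized plans are feasible for the primal problem. -/
theorem le_of_mem_attainable (ha : 0 ≤ a) (hL : Measurable L)
    (hLtop : ∀ x, L x ≠ ⊤) (hκ : 0 ≤ κ) {ε v : ℝ}
    (hv : ∀ Q : ProbabilityMeasure X, otDiv (fDiv a b f) c Q P ≤ (ε : EReal) →
      eint (Q : Measure X) L - (κ : EReal) * otDiv (fDiv a b f) c Q P ≤ (v : EReal))
    {w : ℝ × ℝ × ℝ} (hw : w ∈ attainable a b f c L P κ) (hm : w.1 = 1) (hd : w.2.1 ≤ ε) :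
    w.2.2 ≤ v := by
  obtain ⟨π, φ, h, hm', hd', hv'⟩ := hw
  have hφ0 : ∀ x, 0 ≤ φ x := fun x => (pos_of_mem_realIoo ha (h.mem x)).le
  have hη : IsProbabilityMeasure
      ((P : Measure X).withDensity fun x => ENNReal.ofReal (φ x)) := by
    refine ⟨?_⟩
    rw [withDensity_apply _ MeasurableSet.univ, Measure.restrict_univ,
      ← ofReal_integral_eq_lintegral_ofReal h.integrable (ae_of_all _ hφ0), ← hm', hm,
      ENNReal.ofReal_one]
  have hπ : IsProbabilityMeasure π := by
    refine ⟨?_⟩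
    rw [← preimage_univ (f := Prod.fst), ← Measure.map_apply measurable_fst MeasurableSet.univ,
      h.map_fst]
    exact hη.measure_univ
  have hQ : IsProbabilityMeasure (π.map Prod.snd) :=
    Measure.isProbabilityMeasure_map measurable_snd.aemeasurable
  let η : ProbabilityMeasure X := ⟨_, hη⟩
  let Q : ProbabilityMeasure X := ⟨π.map Prod.snd, hQ⟩
  have hD : fDiv a b f η P = ((∫ x, f (φ x) ∂(P : Measure X) : ℝ) : EReal) := by
    have hac : (η : Measure X) ≪ (P : Measure X) := withDensity_absolutelyContinuous _ _
    rw [fDiv, if_pos hac]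
    refine eint_eq_integral h.integrable_comp ?_
    filter_upwards [Measure.rnDeriv_withDensity (P : Measure X) h.measurable.ennreal_ofReal]
      with x hx
    change fExt a b f (((P : Measure X).withDensity
      fun x => ENNReal.ofReal (φ x)).rnDeriv (P : Measure X) x).toReal = _
    rw [hx, ENNReal.toReal_ofReal (hφ0 x), fExt, if_pos (h.mem x)]
  have hC : otCost c η Q ≤ ∫⁻ p, c p ∂π :=
    iInf₂_le (f := fun (π : ProbabilityMeasure (X × X)) _ => ∫⁻ p, c p ∂(π : Measure (X × X)))
      (⟨π, hπ⟩ : ProbabilityMeasure (X × X)) ⟨h.map_fst, rfl⟩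
  have hot : otDiv (fDiv a b f) c Q P ≤ (planCost f c P π φ : EReal) := by
    refine (iInf_le _ η).trans ?_
    rw [hD, planCost, EReal.coe_add, EReal.coe_ennreal_toReal h.cost_ne_top]
    exact add_le_add le_rfl (EReal.coe_ennreal_le_coe_ennreal_iff.2 hC)
  have hE : eint (Q : Measure X) L = ((∫ p, (L p.2).toReal ∂π : ℝ) : EReal) := by
    change eint (π.map Prod.snd) L = _
    rw [eint_map measurable_snd hL]
    refine eint_eq_integral h.integrable_loss ?_
    filter_upwards [h.ae_ne_bot] with p hp
    exact (EReal.coe_toReal (hLtop _) hp).symm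
  have h1 := hv Q (hot.trans (EReal.coe_le_coe_iff.2 (hd'.trans hd)))
  have h2 : ((∫ p, (L p.2).toReal ∂π - κ * planCost f c P π φ : ℝ) : EReal) ≤
      eint (Q : Measure X) L - (κ : EReal) * otDiv (fDiv a b f) c Q P := by
    rw [hE, EReal.coe_sub, EReal.coe_mul]
    exact EReal.sub_le_sub le_rfl (mul_le_mul_of_nonneg_left hot (by exact_mod_cast hκ))
  exact hv'.trans (EReal.coe_le_coe_iff.1 (h2.trans h1))

/-- The plans that transport along a map. -/
theorem mem_attainable_of_map (ha : 0 ≤ a) (hL : Measurable L)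
    (hc : Measurable c) {φ : X → ℝ} {s : X → X} (hφ : Measurable φ) (hs : Measurable s)
    (hmem : ∀ x, φ x ∈ realIoo a b) (hφi : Integrable φ (P : Measure X))
    (hfi : Integrable (fun x => f (φ x)) (P : Measure X)) (hctop : ∀ x, c (x, s x) ≠ ⊤)
    (hci : Integrable (fun x => φ x * (c (x, s x)).toReal) (P : Measure X))
    (hLi : Integrable (fun x => φ x * (L (s x)).toReal) (P : Measure X))
    (hLbot : ∀ᵐ x ∂(P : Measure X), L (s x) ≠ ⊥) {m d v : ℝ}
    (hm : m = ∫ x, φ x ∂(P : Measure X))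
    (hd : ∫ x, f (φ x) ∂(P : Measure X) + ∫ x, φ x * (c (x, s x)).toReal ∂(P : Measure X) ≤ d)
    (hv : v ≤ ∫ x, φ x * (L (s x)).toReal ∂(P : Measure X) - κ * (∫ x, f (φ x) ∂(P : Measure X) +
      ∫ x, φ x * (c (x, s x)).toReal ∂(P : Measure X))) :
    (m, d, v) ∈ attainable a b f c L P κ := by
  have hφ0 : ∀ x, 0 ≤ φ x := fun x => (pos_of_mem_realIoo ha (hmem x)).le
  set ν := (P : Measure X).withDensity fun x => ENNReal.ofReal (φ x) with hν
  have hg : Measurable fun x => (x, s x) := measurable_id.prodMk hs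
  have hcost : ∫⁻ p, c p ∂(ν.map fun x => (x, s x)) =
      ENNReal.ofReal (∫ x, φ x * (c (x, s x)).toReal ∂(P : Measure X)) := by
    rw [lintegral_map hc hg, hν]
    refine (lintegral_withDensity_eq_lintegral_mul _ hφ.ennreal_ofReal (hc.comp hg)).trans ?_
    rw [ofReal_integral_eq_lintegral_ofReal hci
      (ae_of_all _ fun x => mul_nonneg (hφ0 x) ENNReal.toReal_nonneg)]
    refine lintegral_congr fun x => ?_
    rw [ENNReal.ofReal_mul (hφ0 x), ENNReal.ofReal_toReal (hctop x)]
    rfl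
  have hLm : Measurable fun x => (L (s x)).toReal := (hL.comp hs).ereal_toReal
  have hLm' : Measurable fun p : X × X => (L p.2).toReal := (hL.comp measurable_snd).ereal_toReal
  have hLν : Integrable (fun x => (L (s x)).toReal) ν := by
    rw [hν, integrable_withDensity_iff hφ.ennreal_ofReal
      (ae_of_all _ fun x => ENNReal.ofReal_lt_top)]
    refine hLi.congr (ae_of_all _ fun x => ?_)
    simp only [ENNReal.toReal_ofReal (hφ0 x), mul_comm]
  have hplan : IsPlan a b f c L P (ν.map fun x => (x, s x)) φ := by
    refine ⟨hφ, hmem, hφi, hfi, ?_, ?_, ?_, ?_⟩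
    · rw [Measure.map_map measurable_fst hg]
      exact Measure.map_id
    · rw [hcost]; exact ENNReal.ofReal_ne_top
    · rw [integrable_map_measure hLm'.aestronglyMeasurable hg.aemeasurable]
      exact hLν
    · have hset : MeasurableSet {p : X × X | L p.2 ≠ ⊥} :=
        (hL.comp measurable_snd) (measurableSet_singleton ⊥).compl
      rw [ae_map_iff hg.aemeasurable hset]
      exact (withDensity_absolutelyContinuous _ _).ae_le hLbot
  have hpc : planCost f c P (ν.map fun x => (x, s x)) φ = ∫ x, f (φ x) ∂(P : Measure X) +
      ∫ x, φ x * (c (x, s x)).toReal ∂(P : Measure X) := by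
    rw [planCost, hcost, ENNReal.toReal_ofReal
      (integral_nonneg fun x => mul_nonneg (hφ0 x) ENNReal.toReal_nonneg)]
  have hLint : ∫ p, (L p.2).toReal ∂(ν.map fun x => (x, s x)) =
      ∫ x, φ x * (L (s x)).toReal ∂(P : Measure X) := by
    rw [integral_map hg.aemeasurable hLm'.aestronglyMeasurable, hν,
      integral_withDensity_eq_integral_toReal_smul hφ.ennreal_ofReal
      (ae_of_all _ fun x => ENNReal.ofReal_lt_top)]
    refine integral_congr_ae (ae_of_all _ fun x => ?_)
    simp only [ENNReal.toReal_ofReal (hφ0 x), smul_eq_mul]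
  exact ⟨_, φ, hplan, hm, by rw [hpc]; exact hd, by rw [hpc, hLint]; exact hv⟩

/-- Obtained by integrating the supporting line of f at 1. It bounds the cost from below by an
affine function of the mass, which pays for increasing lam to a positive number. -/
theorem subgradient_le_of_mem_attainable {z : ℝ} (hz : ∀ t ∈ realIoo a b, z * (t - 1) ≤ f t)
    {w : ℝ × ℝ × ℝ} (hw : w ∈ attainable a b f c L P κ) : z * (w.1 - 1) ≤ w.2.1 := by
  obtain ⟨π, φ, h, hm, hd, -⟩ := hw
  have h1 := integral_mono ((h.integrable.sub (integrable_const 1)).const_mul z) h.integrable_comp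
    fun x => hz _ (h.mem x)
  simp only [Pi.sub_apply] at h1
  rw [integral_const_mul, integral_sub h.integrable (integrable_const 1), integral_const,
    probReal_univ, one_smul, ← hm] at h1
  unfold planCost at hd
  linarith [ENNReal.toReal_nonneg (a := ∫⁻ p, c p ∂π)]

/-- Take η = P and the diagonal coupling. Hence P is primal feasible at no penalty. -/
theorem otDiv_self (hf : IsF1 a b f) (hcm : Measurable c) (hc0 : ∀ x, c (x, x) = 0) :
    otDiv (fDiv a b f) c P P = 0 := by
  refine le_antisymm ((iInf_le _ P).trans ?_) (otDiv_nonneg hf c P P)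
  have hg : Measurable fun x : X => (x, x) := measurable_id.prodMk measurable_id
  have hD : fDiv a b f P P = 0 := by
    rw [fDiv, if_pos Measure.AbsolutelyContinuous.rfl]
    rw [eint_eq_integral (integrable_zero _ ℝ _)]
    · simp
    filter_upwards [Measure.rnDeriv_self (P : Measure X)] with x hx
    rw [hx, ENNReal.toReal_one, fExt, if_pos hf.one_mem, hf.map_one]
    rfl
  have hπ : IsProbabilityMeasure ((P : Measure X).map fun x => (x, x)) :=
    Measure.isProbabilityMeasure_map hg.aemeasurable
  have hC : otCost c P P ≤ 0 := by
    refine (iInf₂_le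
      (f := fun (π : ProbabilityMeasure (X × X)) _ => ∫⁻ p, c p ∂(π : Measure (X × X)))
      (⟨_, hπ⟩ : ProbabilityMeasure (X × X)) ⟨?h1, ?h2⟩).trans ?h3
    case h1 => exact (Measure.map_map measurable_fst hg).trans Measure.map_id
    case h2 => exact (Measure.map_map measurable_snd hg).trans Measure.map_id
    case h3 =>
      change ∫⁻ p, c p ∂((P : Measure X).map fun x => (x, x)) ≤ 0
      rw [lintegral_map hcm hg]
      simp [hc0]
  rw [hD, le_antisymm hC bot_le]
  simp

end plans

/-! ### Multipliers for the transport problem. -/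

section strong

variable {X : Type*} [MeasurableSpace X] {a b : EReal} {f : ℝ → ℝ} {c : X × X → ℝ≥0∞}
  {L : X → EReal} {P : ProbabilityMeasure X} {κ ε v : ℝ}

theorem exists_multipliers_attainable (hf : IsF1 a b f) (ha : 0 ≤ a) (hL : Measurable L)
    (hLtop : ∀ x, L x ≠ ⊤) (hcm : Measurable c) (hc0 : ∀ x, c (x, x) = 0) (hε : 0 < ε)
    (hκ : 0 ≤ κ) (hLi : Integrable (fun x => (L x).toReal) (P : Measure X))
    (hLbot : ∀ᵐ x ∂(P : Measure X), L x ≠ ⊥)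
    (hv : ∀ Q : ProbabilityMeasure X, otDiv (fDiv a b f) c Q P ≤ (ε : EReal) →
      eint (Q : Measure X) L - (κ : EReal) * otDiv (fDiv a b f) c Q P ≤ (v : EReal))
    {δ : ℝ} (hδ : 0 < δ) :
    ∃ lam ρ : ℝ, 0 < lam ∧ ∀ w ∈ attainable a b f c L P κ,
      w.2.2 - lam * (w.2.1 - ε) - ρ * (w.1 - 1) ≤ v + δ := by
  set I := ∫ x, (L x).toReal ∂(P : Measure X) with hI
  have hconst : ∀ m d u : ℝ, m ∈ realIoo a b → f m ≤ d → u ≤ m * I - κ * f m →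
      (m, d, u) ∈ attainable a b f c L P κ := by
    intro m d u hm hd hu
    refine mem_attainable_of_map (s := id) (φ := fun _ => m) ha hL hcm measurable_const
      measurable_id (fun _ => hm) (integrable_const _) (integrable_const _) (by simp [hc0])
      (by simp [hc0]) (hLi.const_mul m) hLbot (by simp) (by simpa [hc0] using hd) ?_
    simpa [hc0, integral_const_mul] using hu
  have hev : ∀ᶠ m in 𝓝 (1 : ℝ), m ∈ realIoo a b ∧ f m < 1 := by
    refine ((isOpen_realIoo a b).eventually_mem hf.one_mem).and ?_
    exact (hf.continuousOn.continuousAt ((isOpen_realIoo a b).mem_nhds hf.one_mem)).eventually_lt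
      continuousAt_const (by rw [hf.map_one]; exact one_pos)
  obtain ⟨r, hr, hrm⟩ := Metric.eventually_nhds_iff.1 hev
  -- Constant densities m with |m - 1| < 1 and f(m) < 1 on the diagonal supply the interior: their
  -- cost is below 1 and their value m I - κ f(m) is at least -2|I| - κ. Half of δ is kept for
  -- making lam positive.
  obtain ⟨lam, ρ, hlam, h⟩ := exists_multipliers (convex_attainable hf ha hκ)
    (fun h => absurd (le_of_mem_attainable ha hL hLtop hκ hv h rfl le_rfl)
      (by simpa using half_pos hδ) : ((1 : ℝ), ε, v + δ / 2) ∉ attainable a b f c L P κ)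
    (r := min r 1) (D := 1) (V := -(2 * |I|) - κ) (V₁ := I) (d₀ := 0) (lt_min hr one_pos)
    (by
      intro m d u hm hd hu
      obtain ⟨hmem, hfm⟩ := hrm (y := m) (by
        rw [Real.dist_eq]; exact hm.trans_le (min_le_left _ _))
      refine hconst m d u hmem (by linarith) (hu.trans ?_)
      have h1 : |m - 1| < 1 := hm.trans_le (min_le_right _ _)
      have h2 : |m| ≤ 2 := by
        rw [abs_lt] at h1
        rw [abs_le]
        constructor <;> linarith
      have h3 : |m * I| ≤ 2 * |I| := by
        rw [abs_mul]
        exact mul_le_mul_of_nonneg_right h2 (abs_nonneg _)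
      have h4 := neg_abs_le (m * I)
      have h5 := mul_le_mul_of_nonneg_left hfm.le hκ
      linarith)
    hε
    (by
      intro u hu
      exact hconst 1 0 u hf.one_mem hf.map_one.le (by rw [hf.map_one]; linarith))
  obtain ⟨z, hz⟩ := hf.exists_subgradient
  have ht : 0 < δ / (2 * ε) := by positivity
  -- With τ = δ/(2ε), the shift changes the left side by τ (ε - d + z (m - 1)), where m is the mass
  -- and d the cost. As z (m - 1) ≤ d, this is at most δ/2.
  refine ⟨lam + δ / (2 * ε), ρ - δ / (2 * ε) * z, by positivity, fun w hw => ?_⟩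
  have h1 := h w hw
  have h2 := mul_le_mul_of_nonneg_left (subgradient_le_of_mem_attainable hz hw) ht.le
  have h3 : δ / (2 * ε) * ε = δ / 2 := by field_simp
  nlinarith

end strong

/-! ### Interchange of supremum and integral. -/

section selection

variable {X : Type*} [TopologicalSpace X] [PolishSpace X] [MeasurableSpace X] [BorelSpace X]
  {a b : EReal} {f : ℝ → ℝ} {c : X × X → ℝ≥0∞} {L : X → EReal} {P : ProbabilityMeasure X}
  {κ lam ρ ε : ℝ}

/-- Selection of almost optimal densities and destinations on a set of almost full measure, on
which they are bounded. -/
theorem exists_section_lt_lagr (hf : IsF1 a b f) (ha : 0 ≤ a) (hL : Measurable L)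
    (hLtop : ∀ x, L x ≠ ⊤) (hcm : Measurable c) (hc0 : ∀ x, c (x, x) = 0) (hl : 0 < lam + κ)
    (hLbot : ∀ᵐ x ∂(P : Measure X), L x ≠ ⊥) {g : X → ℝ} (hg : Measurable g)
    (hgF : ∀ᵐ x ∂(P : Measure X), (g x : EReal) < dualIntegrand a b f c L κ lam ρ x)
    {r : ℝ≥0∞} (hr : r < 1) :
    ∃ (B : Set X) (τ : X → ℝ) (s : X → X) (N : ℝ), MeasurableSet B ∧ Measurable τ ∧
      Measurable s ∧ r ≤ (P : Measure X) B ∧ ∀ x ∈ B, τ x ∈ realIoo a b ∧ L (s x) ≠ ⊥ ∧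
        c (x, s x) ≠ ⊤ ∧ g x < lagr f c L (lam + κ) ρ x (τ x) (s x) ∧
        |τ x| ≤ N ∧ |f (τ x)| ≤ N ∧ (c (x, s x)).toReal ≤ N ∧ |(L (s x)).toReal| ≤ N := by
  set F := (realIoo a b).indicator f with hF
  have hFm : Measurable F := hf.measurable_indicator
  have hFf : ∀ t ∈ realIoo a b, F t = f t := fun t ht => indicator_of_mem ht f
  let A : Set (X × (ℝ × X)) := {p | p.2.1 ∈ realIoo a b ∧ L p.2.2 ≠ ⊥ ∧ c (p.1, p.2.2) ≠ ⊤ ∧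
    g p.1 < lagr F c L (lam + κ) ρ p.1 p.2.1 p.2.2}
  have hcm' : Measurable fun p : X × (ℝ × X) => c (p.1, p.2.2) :=
    hcm.comp (measurable_fst.prodMk (measurable_snd.comp measurable_snd))
  have hLm' : Measurable fun p : X × (ℝ × X) => L p.2.2 :=
    hL.comp (measurable_snd.comp measurable_snd)
  have htm : Measurable fun p : X × (ℝ × X) => p.2.1 := measurable_fst.comp measurable_snd
  have hlagr : Measurable fun p : X × (ℝ × X) => lagr F c L (lam + κ) ρ p.1 p.2.1 p.2.2 :=
    (htm.mul (((hLm'.ereal_toReal.div_const _).sub hcm'.ennreal_toReal).sub_const _)).sub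
      (hFm.comp htm)
  have hA : MeasurableSet A :=
    (htm (isOpen_realIoo a b).measurableSet).inter
      ((hLm' (measurableSet_singleton ⊥).compl).inter
        ((hcm' (measurableSet_singleton ⊤).compl).inter
          (measurableSet_lt (hg.comp measurable_fst) hlagr)))
  have hAfull : (P : Measure X) (Prod.fst '' A) = 1 := by
    refine le_antisymm prob_le_one ?_
    rw [← measure_univ (μ := (P : Measure X))]
    refine measure_mono_ae ?_
    filter_upwards [hLbot, hgF] with x hx hgx _
    obtain ⟨t, ht, y, hy, hcy, hlt⟩ := exists_lt_lagr hf ha hl hLtop (hc0 x) hx hgx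
    refine ⟨(x, (t, y)), ⟨ht, hy, hcy, ?_⟩, rfl⟩
    simpa only [lagr, hFf t ht] using hlt
  have : Nonempty X := by
    by_contra h
    rw [not_nonempty_iff] at h
    have := measure_univ (μ := (P : Measure X))
    rw [univ_eq_empty_iff.2 h, measure_empty] at this
    exact zero_ne_one this
  -- The gap between r and r' is spent on restricting B to a set where the selected quantities are
  -- bounded.
  obtain ⟨r', hrr', hr'⟩ := exists_between hr
  obtain ⟨B, σ, hB, hσ, hrB, hBA⟩ := exists_measurable_section (P : Measure X) hA
    (r := r') (by rwa [hAfull])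
  have hτ : Measurable fun x => (σ x).1 := measurable_fst.comp hσ
  have hs : Measurable fun x => (σ x).2 := measurable_snd.comp hσ
  let size : X → ℝ := fun x => |(σ x).1| + |F (σ x).1| + (c (x, (σ x).2)).toReal +
    |(L (σ x).2).toReal|
  have hsize : Measurable size :=
    ((hτ.abs.add (hFm.comp hτ).abs).add (hcm.comp (measurable_id.prodMk hs)).ennreal_toReal).add
      (hL.comp hs).ereal_toReal.abs
  have hU : B = ⋃ n : ℕ, B ∩ {x | size x ≤ n} := by
    rw [← inter_iUnion]
    refine (inter_eq_left.2 fun x _ => ?_).symm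
    exact mem_iUnion.2 (exists_nat_ge (size x))
  have hmono : Monotone fun n : ℕ => B ∩ {x | size x ≤ n} := fun n m h =>
    inter_subset_inter_right _ fun x (hx : size x ≤ n) => hx.trans (by exact_mod_cast h)
  have hlt := hrr'.trans_le hrB
  rw [hU, hmono.measure_iUnion] at hlt
  obtain ⟨n, hn⟩ := lt_iSup_iff.1 hlt
  refine ⟨_, _, _, n, hB.inter (measurableSet_le hsize measurable_const), hτ, hs, hn.le, ?_⟩
  rintro x ⟨hxB, hx⟩
  obtain ⟨h1, h2, h3, h4⟩ := hBA x hxB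
  have hx' : |(σ x).1| + |F (σ x).1| + (c (x, (σ x).2)).toReal + |(L (σ x).2).toReal| ≤ n := hx
  rw [hFf _ h1] at hx'
  have i1 := abs_nonneg (σ x).1
  have i2 := abs_nonneg (f (σ x).1)
  have i3 := ENNReal.toReal_nonneg (a := c (x, (σ x).2))
  have i4 := abs_nonneg (L (σ x).2).toReal
  refine ⟨h1, h2, h3, ?_, by linarith, by linarith, by linarith, by linarith⟩
  have h5 : g x < lagr F c L (lam + κ) ρ x (σ x).1 (σ x).2 := h4
  simpa only [lagr, hFf _ h1] using h5

/-- On a set B of almost full measure, use a selection at which `lagr` exceeds g; elsewhere stay at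
x with density 1. This is a plan, so `hC` applies, and the error off B vanishes as P(B) tends to 1.
-/
theorem integral_le_of_lt_dualIntegrand (hf : IsF1 a b f) (ha : 0 ≤ a) (hL : Measurable L)
    (hLtop : ∀ x, L x ≠ ⊤) (hcm : Measurable c) (hc0 : ∀ x, c (x, x) = 0) (hl : 0 < lam + κ)
    (hLi : Integrable (fun x => (L x).toReal) (P : Measure X))
    (hLbot : ∀ᵐ x ∂(P : Measure X), L x ≠ ⊥) {C : ℝ}
    (hC : ∀ w ∈ attainable a b f c L P κ, w.2.2 - lam * w.2.1 - ρ * w.1 ≤ (lam + κ) * C)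
    {g : X → ℝ} (hg : Measurable g) (hgi : Integrable g (P : Measure X))
    (hgF : ∀ᵐ x ∂(P : Measure X), (g x : EReal) < dualIntegrand a b f c L κ lam ρ x) :
    ∫ x, g x ∂(P : Measure X) ≤ C := by
  classical
  -- K is `lagr` at t = 1 and y = x, minus g: the error made off B.
  set K : X → ℝ := fun x => (L x).toReal / (lam + κ) - ρ / (lam + κ) - g x with hK
  have hKi : Integrable K (P : Measure X) :=
    ((hLi.div_const _).sub (integrable_const _)).sub hgi
  have key : ∀ r : ℝ≥0∞, r < 1 → ∃ B : Set X, MeasurableSet B ∧ r ≤ (P : Measure X) B ∧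
      ∫ x, g x ∂(P : Measure X) + ∫ x in Bᶜ, K x ∂(P : Measure X) ≤ C := by
    intro r hr
    obtain ⟨B, τ, s, N, hB, hτ, hs, hrB, h⟩ :=
      exists_section_lt_lagr hf ha hL hLtop hcm hc0 hl hLbot hg hgF hr
    refine ⟨B, hB, hrB, ?_⟩
    set φ : X → ℝ := fun x => if x ∈ B then τ x else 1 with hφ
    set σ : X → X := fun x => if x ∈ B then s x else x with hσ
    have hφm : Measurable φ := Measurable.ite hB hτ measurable_const
    have hσm : Measurable σ := Measurable.ite hB hs measurable_id
    have hmem : ∀ x, φ x ∈ realIoo a b := by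
      intro x
      by_cases hx : x ∈ B
      · simpa [hφ, hx] using (h x hx).1
      · simpa [hφ, hx] using hf.one_mem
    have hctop : ∀ x, c (x, σ x) ≠ ⊤ := by
      intro x
      by_cases hx : x ∈ B
      · simpa [hσ, hx] using (h x hx).2.2.1
      · simp [hσ, hx, hc0]
    have hbd : ∀ x, |φ x| ≤ |N| + 1 ∧ |f (φ x)| ≤ |N| ∧ |(c (x, σ x)).toReal| ≤ |N| ∧
        |φ x * (L (σ x)).toReal| ≤ |N| * |N| + |(L x).toReal| := by
      intro x
      have hN := le_abs_self N
      by_cases hx : x ∈ B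
      · obtain ⟨-, -, -, -, h5, h6, h7, h8⟩ := h x hx
        simp only [hφ, hσ, hx, if_true]
        refine ⟨by linarith, by linarith, ?_, ?_⟩
        · rw [abs_of_nonneg ENNReal.toReal_nonneg]; linarith
        · rw [abs_mul]
          have := mul_le_mul (h5.trans hN) (h8.trans hN) (abs_nonneg _) (abs_nonneg _)
          linarith [abs_nonneg (L x).toReal]
      · simp only [hφ, hσ, hx, if_false, hf.map_one, hc0]
        refine ⟨by simp, by simp, by simp, ?_⟩
        rw [one_mul]
        linarith [mul_nonneg (abs_nonneg N) (abs_nonneg N)]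
    have hcσ : Measurable fun x => (c (x, σ x)).toReal :=
      (hcm.comp (measurable_id.prodMk hσm)).ennreal_toReal
    have hLσ : Measurable fun x => (L (σ x)).toReal := (hL.comp hσm).ereal_toReal
    have hφi : Integrable φ (P : Measure X) :=
      Integrable.of_bound hφm.aestronglyMeasurable _ (ae_of_all _ fun x => (hbd x).1)
    have hfi : Integrable (fun x => f (φ x)) (P : Measure X) :=
      Integrable.of_bound (hf.measurable_comp hφm hmem).aestronglyMeasurable _
        (ae_of_all _ fun x => (hbd x).2.1)
    have hci : Integrable (fun x => φ x * (c (x, σ x)).toReal) (P : Measure X) := by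
      refine Integrable.of_bound (hφm.mul hcσ).aestronglyMeasurable ((|N| + 1) * |N|)
        (ae_of_all _ fun x => ?_)
      rw [Real.norm_eq_abs, abs_mul]
      exact mul_le_mul (hbd x).1 (hbd x).2.2.1 (abs_nonneg _) (by positivity)
    have hLσi : Integrable (fun x => φ x * (L (σ x)).toReal) (P : Measure X) :=
      Integrable.mono' ((integrable_const (|N| * |N|)).add hLi.abs)
        (hφm.mul hLσ).aestronglyMeasurable (ae_of_all _ fun x => (hbd x).2.2.2)
    have hLσbot : ∀ᵐ x ∂(P : Measure X), L (σ x) ≠ ⊥ := by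
      filter_upwards [hLbot] with x hx
      by_cases hxB : x ∈ B
      · simpa [hσ, hxB] using (h x hxB).2.1
      · simpa [hσ, hxB] using hx
    have hw := hC _ (mem_attainable_of_map ha hL hcm hφm hσm hmem hφi hfi hctop hci hLσi hLσbot
      rfl le_rfl le_rfl)
    have hpt : ∀ x, (lam + κ) * (g x + Bᶜ.indicator K x) ≤ φ x * (L (σ x)).toReal -
        (lam + κ) * (f (φ x) + φ x * (c (x, σ x)).toReal) - ρ * φ x := by
      intro x
      have hlagr : φ x * (L (σ x)).toReal - (lam + κ) * (f (φ x) + φ x * (c (x, σ x)).toReal) -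
          ρ * φ x = (lam + κ) * lagr f c L (lam + κ) ρ x (φ x) (σ x) := by
        unfold lagr
        field_simp
        ring
      rw [hlagr]
      refine mul_le_mul_of_nonneg_left ?_ hl.le
      by_cases hx : x ∈ B
      · rw [indicator_of_notMem (by simpa using hx), add_zero]
        simpa [hφ, hσ, hx] using (h x hx).2.2.2.1.le
      · rw [indicator_of_mem (by simpa using hx)]
        simp [hφ, hσ, hx, hK, lagr, hc0, hf.map_one]
    have hKB : Integrable (Bᶜ.indicator K) (P : Measure X) := hKi.indicator hB.compl
    have hfci : Integrable (fun x => f (φ x) + φ x * (c (x, σ x)).toReal) (P : Measure X) :=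
      hfi.add hci
    have hLfi : Integrable (fun x => φ x * (L (σ x)).toReal -
        (lam + κ) * (f (φ x) + φ x * (c (x, σ x)).toReal)) (P : Measure X) :=
      hLσi.sub (hfci.const_mul (lam + κ))
    have hle := integral_mono ((hgi.add hKB).const_mul (lam + κ))
      (hLfi.sub (hφi.const_mul ρ)) hpt
    simp only [Pi.add_apply, Pi.sub_apply] at hle
    rw [integral_const_mul, integral_add hgi hKB, integral_indicator hB.compl,
      integral_sub hLfi (hφi.const_mul ρ), integral_sub hLσi (hfci.const_mul (lam + κ)),
      integral_const_mul, integral_const_mul, integral_add hfi hci] at hle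
    refine le_of_mul_le_mul_left ?_ hl
    simp only at hw
    linarith
  have hr : ∀ n : ℕ, (1 - ((n : ℝ≥0∞) + 1)⁻¹) < 1 := fun n =>
    ENNReal.sub_lt_self ENNReal.one_ne_top one_ne_zero
      (ENNReal.inv_ne_zero.2 (ENNReal.add_ne_top.2 ⟨ENNReal.natCast_ne_top n, ENNReal.one_ne_top⟩))
  choose B hB hrB hint using fun n => key _ (hr n)
  have hBc : Tendsto ((P : Measure X) ∘ fun n => (B n)ᶜ) atTop (𝓝 0) := by
    have h0 : Tendsto (fun n : ℕ => ((n : ℝ≥0∞) + 1)⁻¹) atTop (𝓝 0) := by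
      have := (tendsto_add_atTop_iff_nat 1).2 ENNReal.tendsto_inv_nat_nhds_zero
      simpa using this
    refine tendsto_of_tendsto_of_tendsto_of_le_of_le tendsto_const_nhds h0 (fun _ => bot_le)
      fun n => ?_
    simp only [Function.comp_apply]
    rw [prob_compl_eq_one_sub (hB n)]
    exact tsub_le_iff_tsub_le.1 (hrB n)
  have hlim := (tendsto_const_nhds (x := ∫ x, g x ∂(P : Measure X))).add
    (hKi.tendsto_setIntegral_nhds_zero hBc)
  rw [add_zero] at hlim
  exact le_of_tendsto' hlim hint

end selection

/-- Both alternatives for L enter the proof only through this minorant; in the second, L itself is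
almost everywhere real and integrable. -/
theorem exists_integrable_minorant {X : Type*} [MeasurableSpace X] {P : ProbabilityMeasure X}
    {L : X → EReal} (hL : Measurable L)
    (hLbdd : (∃ m : ℝ, ∀ x, (m : EReal) ≤ L x) ∨
      ((∃ M : ℝ, ∀ x, L x ≤ (M : EReal)) ∧
        ∫⁻ x, (-L x).toENNReal ∂(P : Measure X) < ⊤)) :
    ∃ h : X → ℝ, Integrable h (P : Measure X) ∧ ∀ᵐ x ∂(P : Measure X), (h x : EReal) ≤ L x := by
  rcases hLbdd with ⟨m, hm⟩ | ⟨⟨M, hM⟩, hneg⟩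
  · exact ⟨fun _ => m, integrable_const m, ae_of_all _ hm⟩
  · have hpos : ∫⁻ x, (L x).toENNReal ∂(P : Measure X) ≠ ⊤ := by
      refine ((lintegral_mono fun x => EReal.toENNReal_le_toENNReal (hM x)).trans_lt ?_).ne
      rw [lintegral_const, EReal.real_coe_toENNReal]
      exact ENNReal.mul_lt_top ENNReal.ofReal_lt_top (measure_lt_top _ _)
    obtain ⟨h1, h2⟩ := integrable_toReal hL.aemeasurable hpos hneg.ne
    exact ⟨_, h1, h2.mono fun x hx => hx.ge⟩

end OTDRO

/-! ### The duality theorem. -/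

theorem mainTheorem2 {X : Type*} [TopologicalSpace X] [PolishSpace X] [MeasurableSpace X]
    [BorelSpace X] (P : ProbabilityMeasure X)
    (L : X → EReal) (hL : Measurable L) (hLtop : ∀ x, L x ≠ ⊤)
    (hLbdd : (∃ m : ℝ, ∀ x, (m : EReal) ≤ L x) ∨
      ((∃ M : ℝ, ∀ x, L x ≤ (M : EReal)) ∧
        ∫⁻ x, (-L x).toENNReal ∂(P : Measure X) < ⊤))
    (a b : EReal) (ha : 0 ≤ a) (f : ℝ → ℝ) (hf : OTDRO.IsF1 a b f)
    (c : X × X → ℝ≥0∞) (hc : LowerSemicontinuous c) (hc0 : ∀ x, c (x, x) = 0)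
    (ε κ : ℝ) (hε : 0 < ε) (hκ : 0 ≤ κ) :
    (⨆ (Q : ProbabilityMeasure X)
        (_ : OTDRO.otDiv (OTDRO.fDiv a b f) c Q P ≤ (ε : EReal)),
        (OTDRO.eint (Q : Measure X) L -
          (κ : EReal) * OTDRO.otDiv (OTDRO.fDiv a b f) c Q P)) =
      (⨅ (lam : ℝ) (_ : 0 < lam) (ρ : ℝ), OTDRO.dualObjective a b f c L P ε κ lam ρ) ∧
    (∀ lam ρ : ℝ, 0 < lam →
      AEMeasurable (OTDRO.dualIntegrand a b f c L κ lam ρ) (P : Measure X)) ∧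
    OTDRO.EConvexOn (Ioi (0 : ℝ) ×ˢ (univ : Set ℝ))
      (fun p : ℝ × ℝ => OTDRO.dualObjective a b f c L P ε κ p.1 p.2) := by
  obtain ⟨h, hh, hhL⟩ := OTDRO.exists_integrable_minorant hL hLbdd
  have hcm : Measurable c := hc.measurable
  have hminor : ∀ lam ρ : ℝ, Integrable (fun x => h x / (lam + κ) - ρ / (lam + κ))
      (P : Measure X) := fun lam ρ => (hh.div_const _).sub (integrable_const _)
  refine ⟨le_antisymm ?_ ?_, fun lam ρ _ => OTDRO.aemeasurable_dualIntegrand hL hc _,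
    OTDRO.econvexOn_dualObjective hL hLtop hh hhL hf ha hc hc0 hκ⟩
  · refine iSup₂_le fun Q hQ => le_iInf₂ fun lam hlam => le_iInf fun ρ => ?_
    exact OTDRO.weak_duality hf hcm hL hLtop hlam hκ (OTDRO.aemeasurable_regLoss hL hc _ _)
      (hminor lam ρ) (OTDRO.ae_le_dualIntegrand hf ha (by positivity) hLtop hc0 hhL) hQ
  · set V := ⨆ (Q : ProbabilityMeasure X)
        (_ : OTDRO.otDiv (OTDRO.fDiv a b f) c Q P ≤ (ε : EReal)),
        (OTDRO.eint (Q : Measure X) L -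
          (κ : EReal) * OTDRO.otDiv (OTDRO.fDiv a b f) c Q P) with hV
    have hVQ : ∀ Q : ProbabilityMeasure X, OTDRO.otDiv (OTDRO.fDiv a b f) c Q P ≤ (ε : EReal) →
        OTDRO.eint (Q : Measure X) L -
          (κ : EReal) * OTDRO.otDiv (OTDRO.fDiv a b f) c Q P ≤ V := fun Q hQ =>
      le_iSup₂ (f := fun (Q : ProbabilityMeasure X)
        (_ : OTDRO.otDiv (OTDRO.fDiv a b f) c Q P ≤ (ε : EReal)) =>
        OTDRO.eint (Q : Measure X) L -
          (κ : EReal) * OTDRO.otDiv (OTDRO.fDiv a b f) c Q P) Q hQ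
    have hPV : OTDRO.eint (P : Measure X) L ≤ V := by
      have := hVQ P (by rw [OTDRO.otDiv_self hf hcm hc0]; exact_mod_cast hε.le)
      rwa [OTDRO.otDiv_self hf hcm hc0, mul_zero, sub_zero] at this
    by_cases hVtop : V = ⊤
    · rw [hVtop]; exact le_top
    -- Feasibility of P and the minorant exclude V = ⊥. A finite V moreover makes L integrable under
    -- P, as the multipliers require.
    obtain ⟨v, hv⟩ : ∃ v : ℝ, V = (v : EReal) :=
      ⟨_, (EReal.coe_toReal hVtop ((OTDRO.bot_lt_eint hh hhL).trans_le hPV).ne').symm⟩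
    rw [hv] at hVQ hPV ⊢
    obtain ⟨hLi, hLe⟩ := OTDRO.integrable_toReal_of_eint_ne_top hL.aemeasurable hh hhL
      (ne_top_of_le_ne_top (EReal.coe_ne_top v) hPV)
    have hLbot : ∀ᵐ x ∂(P : Measure X), L x ≠ ⊥ := by
      filter_upwards [hhL] with x hx
      exact ne_bot_of_le_ne_bot (EReal.coe_ne_bot _) hx
    -- Multipliers with δ = z - v make the dual objective at most z, for each real z > v; the dual
    -- infimum need not be attained.
    refine EReal.le_of_forall_lt_iff_le.1 fun z hz => ?_
    rw [EReal.coe_lt_coe_iff] at hz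
    obtain ⟨lam, ρ, hlam, hw⟩ := OTDRO.exists_multipliers_attainable hf ha hL hLtop hcm hc0 hε hκ
      hLi hLbot hVQ (sub_pos.2 hz)
    have hl : 0 < lam + κ := by positivity
    refine (iInf₂_le_of_le lam hlam (iInf_le _ ρ)).trans ?_
    have hF : OTDRO.eint (P : Measure X) (OTDRO.dualIntegrand a b f c L κ lam ρ) ≤
        (((z - lam * ε - ρ) / (lam + κ) : ℝ) : EReal) := by
      refine OTDRO.eint_le_of_forall_lt (OTDRO.aemeasurable_dualIntegrand hL hc _) (hminor lam ρ)
        (OTDRO.ae_le_dualIntegrand hf ha hl hLtop hc0 hhL) fun g hg hgi hgF => ?_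
      refine OTDRO.integral_le_of_lt_dualIntegrand hf ha hL hLtop hcm hc0 hl hLi hLbot
        (fun w hwW => ?_) hg hgi hgF
      rw [mul_div_cancel₀ _ hl.ne']
      linarith [hw w hwW]
    refine (add_le_add_right (mul_le_mul_of_nonneg_left hF (by exact_mod_cast hl.le)) _).trans ?_
    rw [← EReal.coe_mul, ← EReal.coe_add, EReal.coe_le_coe_iff, mul_div_cancel₀ _ hl.ne']
    linarith
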